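/- Let $d\in\mathbb N$. A lattice in $\mathbb R^d$ is a set of the form $\Lambda=\{\sum_{i=1}^d k_i\mathbf a_i : k_i\in\mathbb Z\}$ for a basis $\mathbf a_1,\dots,\mathbf a_d$ of $\mathbb R^d$; $\det(\Lambda)=|\det(\mathbf a_1,\dots,\mathbf a_d)|$ is its determinant (the volume of a fundamental region). An $\mathbb R^d$-valued random variable is non-degenerate if its support is not contained in a $(d-1)$-dimensional affine subspace. The main lattice of an $\mathbb R^d$-valued random variable with support $\mathcal S$ is the smallest lattice containing $\mathcal S-\mathbf c$, where $\mathbf c\in\mathcal S$ (if it exists, it does not depend on the choice of $\mathbf c$). Theorem. For each $n\ge 1$ let $\mathbf X_n$ be an $\mathbb R^d$-valued random variable and let $\mathbf X_{n,1},\dots,\mathbf X_{n,n}$ be i.i.d. copies of $\mathbf X_n$ (the spaces on which these are defined may depend on $n$). Assume: 1. there is a non-degenerate $\mathbb R^d$-valued random variable $\mathbf X$ such that $\mathbf X_n\to\mathbf X$ in distribution as $n\to\infty$; 2. there is a lattice $\Lambda$ which is the main lattice of $\mathbf X$ and of every $\mathbf X_n$; 3. $(\|\mathbf X_n\|^2)_{n\ge1}$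 is uniformly integrable, i.e. $\lim_{L\to\infty}\sup_{n\ge1}\mathbb E\big[\|\mathbf X_n\|^2\mathbf 1\{\|\mathbf X_n\|^2>L\}\big]=0$, where $\|\cdot\|$ is the Euclidean norm. Then $\mathbf X$ has finite second moment and $\Sigma=\operatorname{Cov}(\mathbf X)$ is positive definite, so that $N(0,\Sigma)$ has the density $$f(\mathbf x)=\frac{1}{\sqrt{(2\pi)^d\det\Sigma}}\exp\Big(-\tfrac12\,\mathbf x\cdot\Sigma^{-1}\mathbf x\Big).$$ Moreover, whenever $\mathbf c_n\in\mathbb R^d$ $(n\ge1)$ are such that $\mathbf c_n+\Lambda$ contains the support of $\sum_{i=1}^n\mathbf X_{n,i}$ for every $n$, then uniformly for $\mathbf y\in\mathbf c_n+\Lambda$ $$\mathbb P\Big(\sum_{i=1}^n\mathbf X_{n,i}=\mathbf y\Big)=n^{-d/2}\det(\Lambda)\,f\Big(\frac{\mathbf y-n\,\mathbb E[\mathbf X_n]}{\sqrt n}\Big)+o(n^{-d/2}),$$ that is, $$\lim_{n\to\infty}\ \sup_{\mathbf y\in\mathbf c_n+\Lambda}\left|\,n^{d/2}\,\mathbb P\Big(\sum_{i=1}^n\mathbf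 X_{n,i}=\mathbf y\Big)-\det(\Lambda)\,f\Big(\frac{\mathbf y-n\,\mathbb E[\mathbf X_n]}{\sqrt n}\Big)\right|=0.$$ -/

import Mathlib

open MeasureTheory ProbabilityTheory Filter Topology
open scoped ENNReal

namespace LatticeLLT

noncomputable section

/-- A lattice in `ℝ^d`: the set of integer combinations of some basis of `ℝ^d`. -/
def IsLattice {d : ℕ} (Λ : Submodule ℤ (EuclideanSpace ℝ (Fin d))) : Prop :=
  ∃ b : Module.Basis (Fin d) ℝ (EuclideanSpace ℝ (Fin d)), Λ = Submodule.span ℤ (Set.range b)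

/-- The determinant of a lattice, i.e. the volume of a fundamental region;
see `latticeDet_eq_abs_det`. -/
def latticeDet {d : ℕ} (Λ : Submodule ℤ (EuclideanSpace ℝ (Fin d))) : ℝ :=
  ZLattice.covolume Λ

/-- The translate `c + Λ`. -/
def coset {d : ℕ} (c : EuclideanSpace ℝ (Fin d))
    (Λ : Submodule ℤ (EuclideanSpace ℝ (Fin d))) : Set (EuclideanSpace ℝ (Fin d)) :=
  {y | ∃ v ∈ Λ, y = c + v}

/-- The law `μ` is not supported in a `(d-1)`-dimensional affine subspace of `ℝ^d`. -/
def IsNondegenerate {d : ℕ} (μ : Measure (EuclideanSpace ℝ (Fin d))) : Prop :=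
  ¬ ∃ A : AffineSubspace ℝ (EuclideanSpace ℝ (Fin d)),
    Module.finrank ℝ A.direction + 1 = d ∧ μ.support ⊆ (A : Set (EuclideanSpace ℝ (Fin d)))

/-- `Λ` is the main lattice of the law `μ`: the smallest lattice containing `S - c`, where `S` is
the support of `μ` and `c` is a point of `S` (the choice of `c` does not matter, since `S - c` and
`S - c'` generate the same group). -/
def IsMainLattice {d : ℕ} (μ : Measure (EuclideanSpace ℝ (Fin d)))
    (Λ : Submodule ℤ (EuclideanSpace ℝ (Fin d))) : Prop :=
  ∃ c ∈ μ.support,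
    IsLeast {L : Submodule ℤ (EuclideanSpace ℝ (Fin d)) |
      IsLattice L ∧ ∀ x ∈ μ.support, x - c ∈ L} Λ

/-- The covariance matrix of an `ℝ^d`-valued random variable. -/
def covMat {d : ℕ} {Ω : Type*} [MeasurableSpace Ω] (X : Ω → EuclideanSpace ℝ (Fin d))
    (P : Measure Ω) : Matrix (Fin d) (Fin d) ℝ :=
  Matrix.of fun i j => cov[fun ω => X ω i, fun ω => X ω j; P]

/-- The density of the centred normal law `N(0, S)` on `ℝ^d`, for positive definite `S`. -/
def gaussianDensity {d : ℕ} (S : Matrix (Fin d) (Fin d) ℝ)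
    (x : EuclideanSpace ℝ (Fin d)) : ℝ :=
  1 / Real.sqrt ((2 * Real.pi) ^ d * S.det) *
    Real.exp (-(1 / 2) * (WithLp.ofLp x ⬝ᵥ S⁻¹.mulVec (WithLp.ofLp x)))

/-- For a lattice generated by a basis `b`, the determinant is the absolute value of the
determinant of the matrix of coordinates of `b`. -/
theorem latticeDet_eq_abs_det {d : ℕ}
    (b : Module.Basis (Fin d) ℝ (EuclideanSpace ℝ (Fin d))) :
    latticeDet (Submodule.span ℤ (Set.range b)) =
      |(Matrix.of fun i j => b j i : Matrix (Fin d) (Fin d) ℝ).det| := by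
  unfold latticeDet
  rw [ZLattice.covolume_eq_det_mul_measureReal _ volume (b.restrictScalars ℤ)
    (EuclideanSpace.basisFun (Fin d) ℝ).toBasis]
  have h1 : volume.real (ZSpan.fundamentalDomain
      (EuclideanSpace.basisFun (Fin d) ℝ).toBasis) = 1 := by
    rw [measureReal_congr (ZSpan.fundamentalDomain_ae_parallelepiped _ _)]
    simp [Measure.real, (EuclideanSpace.basisFun (Fin d) ℝ).volume_parallelepiped]
  rw [h1, mul_one, Module.Basis.det_apply]
  congr 2
  ext i j
  simp [Module.Basis.toMatrix_apply]

/-- If the integer combinations of `S - c` form a lattice, that lattice is the main lattice. -/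
theorem isMainLattice_span {d : ℕ} (μ : Measure (EuclideanSpace ℝ (Fin d)))
    (c : EuclideanSpace ℝ (Fin d)) (hc : c ∈ μ.support)
    (h : IsLattice (Submodule.span ℤ ((fun x => x - c) '' μ.support))) :
    IsMainLattice μ (Submodule.span ℤ ((fun x => x - c) '' μ.support)) := by
  refine ⟨c, hc, ⟨h, fun x hx => Submodule.subset_span ⟨x, hx, rfl⟩⟩, fun L hL => ?_⟩
  rw [Submodule.span_le]
  rintro _ ⟨x, hx, rfl⟩
  exact hL.2 x hx

end

end LatticeLLT

/-! The proof is Fourier inversion plus dominated convergence. Let `b` be a basis of Λ and let the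
dual cell be the set of frequencies t with |⟨b_j, t⟩| ≤ π for all j. A law on a coset of Λ has its
atom at y equal to det(Λ)/(2π)^d times the integral over the dual cell of its characteristic
function against the phase exp(-i⟨y, t⟩). After the substitution t = u/√n and centring, n^{d/2}
times the probability is the Fourier integral of H_n, the centred and normalised characteristic
function of the sum cut off outside the rescaled cell. The Gaussian density is the same integral of
G(u) = exp(-uᵀΣu/2). The phase has modulus one, so the error is at most det(Λ)/(2π)^d times the L¹
norm of H_n - G, whatever y is.

Pointwise convergence H_n → G (`tendsto_charFun_pow`) is the Lindeberg argument: uniform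
integrability makes the second-order Taylor remainders negligible and makes the variances converge.

Domination needs ‖charFun (μ n) t‖ ≤ exp(-a‖t‖²) on the whole dual cell, with a > 0 independent of
n. By symmetrisation 1 - |φ_n(t)|² = E[1 - cos⟨X_n - X_n', t⟩], with X_n' an independent copy of
X_n. If x and y lie in the support of the limit, small balls around them eventually carry mass
bounded below, and discreteness of Λ forces two samples from these balls to differ by exactly x - y.
Hence 1 - cos⟨x - y, t⟩ ≤ C(1 - |φ_n(t)|²). Such bounds survive sums and negation, and the
differences x - y generate Λ because Λ is the main lattice of the limit
(`IsMainLattice.exists_eq_span`). So they hold for each b_j, and on the dual cell they become the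
Gaussian bound (`exists_eventually_norm_charFun_le`). -/

namespace LatticeLLT

/-! ### Uniform integrability of the squared norm -/

section UniformSquareIntegrability

variable {ι E : Type*} [NormedAddCommGroup E] [MeasurableSpace E]

/-- Uniform integrability of the squared norm for a family of laws. -/
def UniformlySquareIntegrable (μ : ι → Measure E) : Prop :=
  (∀ i, Integrable (fun x => ‖x‖ ^ 2) (μ i)) ∧
    ∀ ε > 0, ∃ R : ℝ, 1 ≤ R ∧ ∀ i, ∫ x in {x | R < ‖x‖}, ‖x‖ ^ 2 ∂(μ i) ≤ ε

variable [BorelSpace E]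

/-- Split at radius `R`: inside the ball the integrand is at most `ε`, and outside it `1 ≤ R < ‖x‖`
gives 1 + ‖x‖² ≤ 2‖x‖², whence the factor 2. -/
theorem norm_integral_le_add_tail {F : Type*} [NormedAddCommGroup F] [NormedSpace ℝ F]
    {μ : Measure E} [IsProbabilityMeasure μ]
    (hμ : Integrable (fun x => ‖x‖ ^ 2) μ) {g : E → F} {C ε R : ℝ} (hε : 0 ≤ ε)
    (hR : 1 ≤ R) (hgC : ∀ x, ‖g x‖ ≤ C * (1 + ‖x‖ ^ 2)) (hgR : ∀ x, ‖x‖ ≤ R → ‖g x‖ ≤ ε) :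
    ‖∫ x, g x ∂μ‖ ≤ ε + 2 * C * ∫ x in {x | R < ‖x‖}, ‖x‖ ^ 2 ∂μ := by
  have hC : 0 ≤ C := by
    have := (norm_nonneg _).trans (hgC 0)
    simpa using this
  have hms : MeasurableSet {x : E | R < ‖x‖} := measurableSet_lt measurable_const measurable_norm
  have hint : Integrable (fun x => ε + 2 * C * ({x : E | R < ‖x‖}.indicator (fun x => ‖x‖ ^ 2) x)) μ :=
    (integrable_const _).add ((hμ.indicator hms).const_mul _)
  calc ‖∫ x, g x ∂μ‖
      ≤ ∫ x, (ε + 2 * C * ({x : E | R < ‖x‖}.indicator (fun x => ‖x‖ ^ 2) x)) ∂μ := by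
        refine norm_integral_le_of_norm_le hint (ae_of_all _ fun x => ?_)
        by_cases hx : R < ‖x‖
        · rw [Set.indicator_of_mem (by exact hx)]
          have h1 : (1 : ℝ) ≤ ‖x‖ ^ 2 := one_le_pow₀ (hR.trans hx.le)
          nlinarith [hgC x, mul_le_mul_of_nonneg_left h1 hC]
        · rw [Set.indicator_of_notMem (by exact hx)]
          simpa using hgR x (not_lt.1 hx)
    _ = ε + 2 * C * ∫ x in {x | R < ‖x‖}, ‖x‖ ^ 2 ∂μ := by
        rw [integral_add (integrable_const _) ((hμ.indicator hms).const_mul _),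
          integral_const_mul, integral_indicator hms]
        simp

theorem UniformlySquareIntegrable.exists_integral_le {μ : ι → Measure E}
    [∀ i, IsProbabilityMeasure (μ i)] (h : UniformlySquareIntegrable μ) :
    ∃ M : ℝ, 0 ≤ M ∧ ∀ i, ∫ x, ‖x‖ ^ 2 ∂(μ i) ≤ M := by
  obtain ⟨R, hR, hμ⟩ := h.2 1 one_pos
  refine ⟨R ^ 2 + 2 * 1 * 1, by positivity, fun i => ?_⟩
  have := norm_integral_le_add_tail (h.1 i) (g := fun x => ‖x‖ ^ 2) (C := 1) (ε := R ^ 2)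
    (by positivity) hR (fun x => by simp) (fun x hx => by
      simpa using pow_le_pow_left₀ (norm_nonneg _) hx 2)
  have h2 := (le_abs_self _).trans this
  linarith [hμ i]

/-- Functions of at most quadratic growth tending to zero uniformly on balls have integrals
tending to zero. -/
theorem UniformlySquareIntegrable.tendsto_integral_zero {F : Type*} [NormedAddCommGroup F]
    [NormedSpace ℝ F] {μ : ι → Measure E}
    [∀ i, IsProbabilityMeasure (μ i)] (h : UniformlySquareIntegrable μ) {l : Filter ι}
    {g : ι → E → F} {C : ℝ} (hgC : ∀ i x, ‖g i x‖ ≤ C * (1 + ‖x‖ ^ 2))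
    (hg : ∀ R : ℝ, ∀ ε > 0, ∀ᶠ i in l, ∀ x, ‖x‖ ≤ R → ‖g i x‖ ≤ ε) :
    Tendsto (fun i => ∫ x, g i x ∂(μ i)) l (𝓝 0) := by
  rw [Metric.tendsto_nhds]
  intro ε hε
  obtain ⟨R, hR, hμ⟩ := h.2 (ε / (4 * (|C| + 1))) (by positivity)
  filter_upwards [hg R (ε / 4) (by positivity)] with i hi
  have := norm_integral_le_add_tail (h.1 i) (g := g i) (C := |C|) (ε := ε / 4)
    (by positivity) hR (fun x => (hgC i x).trans (by gcongr; exact le_abs_self C)) hi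
  have h3 : 2 * |C| * ∫ x in {x | R < ‖x‖}, ‖x‖ ^ 2 ∂(μ i) ≤ ε / 2 := by
    calc 2 * |C| * ∫ x in {x | R < ‖x‖}, ‖x‖ ^ 2 ∂(μ i)
        ≤ 2 * |C| * (ε / (4 * (|C| + 1))) := by gcongr; exact hμ i
      _ = ε / 2 * (|C| / (|C| + 1)) := by field_simp; ring
      _ ≤ ε / 2 * 1 := by
        gcongr
        rw [div_le_one (by positivity)]
        linarith
      _ = ε / 2 := mul_one _
  rw [dist_zero_right]
  linarith

omit [BorelSpace E] in
theorem integrable_of_quadratic_growth {F : Type*} [NormedAddCommGroup F]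
    {μ : Measure E} [IsFiniteMeasure μ]
    (hμ : Integrable (fun x => ‖x‖ ^ 2) μ) {g : E → F} {C : ℝ}
    (hg : AEStronglyMeasurable g μ) (hgC : ∀ x, ‖g x‖ ≤ C * (1 + ‖x‖ ^ 2)) : Integrable g μ :=
  Integrable.mono' (((integrable_const (1 : ℝ)).add hμ).const_mul C) hg (ae_of_all _ hgC)

theorem exists_tail_le {μ : Measure E} (hμ : Integrable (fun x => ‖x‖ ^ 2) μ) {ε : ℝ}
    (hε : 0 < ε) : ∃ R₀ : ℝ, ∀ R ≥ R₀, ∫ x in {x | R < ‖x‖}, ‖x‖ ^ 2 ∂μ ≤ ε := by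
  have hms (R : ℝ) : MeasurableSet {x : E | R < ‖x‖} :=
    measurableSet_lt measurable_const measurable_norm
  have h1 : Tendsto (fun R : ℝ => ∫ x in {x | R < ‖x‖}, ‖x‖ ^ 2 ∂μ) atTop
      (𝓝 (∫ x : E, (0 : ℝ) ∂μ)) := by
    simp_rw [← integral_indicator (hms _)]
    refine tendsto_integral_filter_of_dominated_convergence (fun x => ‖x‖ ^ 2)
      (Eventually.of_forall fun R => (hμ.indicator (hms R)).1)
      (Eventually.of_forall fun R => ae_of_all _ fun x => ?_) hμ (ae_of_all _ fun x => ?_)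
    · refine (norm_indicator_le_norm_self _ _).trans (by simp)
    · refine tendsto_const_nhds.congr' ?_
      filter_upwards [eventually_ge_atTop ‖x‖] with R hR
      rw [Set.indicator_of_notMem (by simpa using hR)]
  rw [integral_zero] at h1
  obtain ⟨R₀, h⟩ := eventually_atTop.1 (h1.eventually_le_const hε)
  exact ⟨R₀, h⟩

/-- Fatou's lemma for weak convergence: the portmanteau inequality on open sets bounds the second
moment of the limit by the common bound `M`. It is applied along a sequence tending to `l`. -/
theorem integrable_norm_sq_of_tendsto {μ : ι → ProbabilityMeasure E}
    {μ₀ : ProbabilityMeasure E} {l : Filter ι} [l.NeBot] [l.IsCountablyGenerated]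
    (hlim : Tendsto μ l (𝓝 μ₀)) (h : UniformlySquareIntegrable fun i => (μ i : Measure E)) :
    Integrable (fun x => ‖x‖ ^ 2) (μ₀ : Measure E) := by
  obtain ⟨M, hM0, hM⟩ := h.exists_integral_le
  obtain ⟨s, hs⟩ := exists_seq_tendsto l
  have hcont : Continuous fun x : E => ‖x‖ ^ 2 := by fun_prop
  have h1 := lintegral_le_liminf_lintegral_of_forall_isOpen_measure_le_liminf_measure
    (μ := (μ₀ : Measure E)) (μs := fun k => (μ (s k) : Measure E)) hcont (fun x => by positivity)
    (fun G hG => ProbabilityMeasure.le_liminf_measure_open_of_tendsto (hlim.comp hs) hG)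
  have h2 : ∫⁻ x, ENNReal.ofReal (‖x‖ ^ 2) ∂(μ₀ : Measure E) ≤ ENNReal.ofReal M := by
    refine h1.trans ?_
    refine (liminf_le_liminf (v := fun _ => ENNReal.ofReal M)
      (Eventually.of_forall fun k => ?_)).trans (by simp)
    rw [← ofReal_integral_eq_lintegral_ofReal (h.1 _) (ae_of_all _ fun x => by positivity)]
    exact ENNReal.ofReal_le_ofReal (hM _)
  refine ⟨hcont.aestronglyMeasurable, ?_⟩
  rw [hasFiniteIntegral_iff_ofReal (ae_of_all _ fun x => by positivity)]
  exact h2.trans_lt ENNReal.ofReal_lt_top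

/-- Weak convergence and uniform integrability give convergence of the integrals of continuous
functions of at most quadratic growth. -/
theorem tendsto_integral_of_quadratic_growth {μ : ι → ProbabilityMeasure E}
    {μ₀ : ProbabilityMeasure E} {l : Filter ι} [l.NeBot] [l.IsCountablyGenerated]
    (hlim : Tendsto μ l (𝓝 μ₀)) (h : UniformlySquareIntegrable fun i => (μ i : Measure E))
    {f : E → ℝ} {C : ℝ} (hf : Continuous f) (hfC : ∀ x, ‖f x‖ ≤ C * (1 + ‖x‖ ^ 2)) :
    Tendsto (fun i => ∫ x, f x ∂(μ i : Measure E)) l (𝓝 (∫ x, f x ∂(μ₀ : Measure E))) := by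
  have h₀ := integrable_norm_sq_of_tendsto hlim h
  have hC : 0 ≤ C := by
    have := (norm_nonneg _).trans (hfC 0)
    simpa using this
  rw [Metric.tendsto_nhds]
  intro ε hε
  obtain ⟨R₁, hR₁, hμ⟩ := h.2 (ε / (8 * (C + 1))) (by positivity)
  obtain ⟨R₂, hμ₀⟩ := exists_tail_le h₀ (ε := ε / (8 * (C + 1))) (by positivity)
  set R := max R₁ R₂ with hRdef
  have hR : 1 ≤ R := hR₁.trans (le_max_left _ _)
  -- Multiplying `f` by a continuous cutoff, equal to 1 for ‖x‖ ≤ R and to 0 for ‖x‖ ≥ R + 1, costs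
  -- at most ε/4 under each law. The product is bounded and continuous, so weak convergence applies
  -- to it; the three errors add up to less than ε.
  have htail (ν : Measure E) [IsProbabilityMeasure ν] (hν : Integrable (fun x => ‖x‖ ^ 2) ν)
      (hνR : ∫ x in {x | R < ‖x‖}, ‖x‖ ^ 2 ∂ν ≤ ε / (8 * (C + 1))) :
      ‖∫ x, f x ∂ν - ∫ x, f x * max 0 (min 1 (R + 1 - ‖x‖)) ∂ν‖ ≤ ε / 4 := by
    have hχ (x : E) : 0 ≤ max 0 (min 1 (R + 1 - ‖x‖)) ∧ max 0 (min 1 (R + 1 - ‖x‖)) ≤ 1 :=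
      ⟨le_max_left _ _, max_le zero_le_one (min_le_left _ _)⟩
    have hm : Continuous fun x : E => f x * max 0 (min 1 (R + 1 - ‖x‖)) := by fun_prop
    have hb (x : E) : ‖f x * max 0 (min 1 (R + 1 - ‖x‖))‖ ≤ C * (1 + ‖x‖ ^ 2) := by
      rw [norm_mul, Real.norm_of_nonneg (hχ x).1]
      exact (mul_le_of_le_one_right (norm_nonneg _) (hχ x).2).trans (hfC x)
    rw [← integral_sub (integrable_of_quadratic_growth hν hf.aestronglyMeasurable hfC)
      (integrable_of_quadratic_growth hν hm.aestronglyMeasurable hb)]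
    refine (norm_integral_le_add_tail hν (C := C) (ε := 0) le_rfl hR (fun x => ?_)
      (fun x hx => ?_)).trans ?_
    · rw [← mul_one_sub, norm_mul]
      refine (mul_le_of_le_one_right (norm_nonneg _) ?_).trans (hfC x)
      rw [Real.norm_of_nonneg (by linarith [(hχ x).2])]
      linarith [(hχ x).1]
    · rw [min_eq_left (by linarith)]
      simp
    · calc 0 + 2 * C * ∫ x in {x | R < ‖x‖}, ‖x‖ ^ 2 ∂ν
          ≤ 0 + 2 * C * (ε / (8 * (C + 1))) := by gcongr
        _ = ε / 4 * (C / (C + 1)) := by field_simp; ring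
        _ ≤ ε / 4 * 1 := by
          gcongr
          rw [div_le_one (by positivity)]
          linarith
        _ = ε / 4 := mul_one _
  have hbdd : ∀ x : E, ‖f x * max 0 (min 1 (R + 1 - ‖x‖))‖ ≤ C * (1 + (R + 1) ^ 2) := by
    intro x
    rw [norm_mul, Real.norm_of_nonneg (le_max_left _ _)]
    by_cases hx : ‖x‖ ≤ R + 1
    · refine (mul_le_of_le_one_right (norm_nonneg _)
        (max_le zero_le_one (min_le_left _ _))).trans ((hfC x).trans ?_)
      gcongr
    · rw [max_eq_left ((min_le_right _ _).trans (by linarith)), mul_zero]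
      positivity
  let φ : BoundedContinuousFunction E ℝ :=
    BoundedContinuousFunction.ofNormedAddCommGroup
      (fun x => f x * max 0 (min 1 (R + 1 - ‖x‖))) (by fun_prop) _ hbdd
  have hφ := ProbabilityMeasure.tendsto_iff_forall_integral_tendsto.1 hlim φ
  filter_upwards [Metric.tendsto_nhds.1 hφ (ε / 4) (by positivity)] with i hi
  have hmono (ν : Measure E) (hν : Integrable (fun x => ‖x‖ ^ 2) ν) :
      ∫ x in {x | R < ‖x‖}, ‖x‖ ^ 2 ∂ν ≤ ∫ x in {x | R₁ < ‖x‖}, ‖x‖ ^ 2 ∂ν :=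
    setIntegral_mono_set hν.integrableOn (ae_of_all _ fun x => by positivity)
      (LE.le.eventuallyLE fun x (hx : R < ‖x‖) => (le_max_left R₁ R₂).trans_lt hx)
  have h1 := htail (μ i) (h.1 i) ((hmono _ (h.1 i)).trans (hμ i))
  have h2 := htail μ₀ h₀ (hμ₀ R (le_max_right _ _))
  change dist (∫ x, f x * max 0 (min 1 (R + 1 - ‖x‖)) ∂(μ i : Measure E))
    (∫ x, f x * max 0 (min 1 (R + 1 - ‖x‖)) ∂(μ₀ : Measure E)) < ε / 4 at hi
  rw [Real.dist_eq] at hi ⊢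
  rw [Real.norm_eq_abs, abs_le] at h1 h2
  rw [abs_lt] at hi ⊢
  constructor <;> linarith [h1.1, h1.2, h2.1, h2.2, hi.1, hi.2]

end UniformSquareIntegrability

/-! ### Main lattices and nondegeneracy -/

section MainLattice

variable {d : ℕ}

theorem IsLattice.discreteTopology {Λ : Submodule ℤ (EuclideanSpace ℝ (Fin d))}
    (h : IsLattice Λ) : DiscreteTopology Λ := by
  obtain ⟨b, rfl⟩ := h
  infer_instance

theorem isLattice_of_discrete_of_span {L : Submodule ℤ (EuclideanSpace ℝ (Fin d))}
    [DiscreteTopology L] (h : Submodule.span ℝ (L : Set (EuclideanSpace ℝ (Fin d))) = ⊤) :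
    IsLattice L := by
  have : IsZLattice ℝ L := ⟨h⟩
  have hfr : Module.finrank ℤ L = d := by
    rw [ZLattice.rank ℝ]
    simp
  let b₀ : Module.Basis (Fin d) ℤ L := (Module.Free.chooseBasis ℤ L).reindex
    (Fintype.equivOfCardEq (by
      rw [← Module.finrank_eq_card_chooseBasisIndex, hfr, Fintype.card_fin]))
  exact ⟨b₀.ofZLatticeBasis ℝ L, (b₀.ofZLatticeBasis_span ℝ).symm⟩

/-- Otherwise a nonzero linear functional kills all differences, and the support lies in a translate
of its kernel, a hyperplane. -/
theorem IsNondegenerate.span_sub_eq_top {μ : Measure (EuclideanSpace ℝ (Fin d))}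
    (h : IsNondegenerate μ) (c : EuclideanSpace ℝ (Fin d)) :
    Submodule.span ℝ ((fun x => x - c) '' μ.support) = ⊤ := by
  by_contra hne
  obtain ⟨f, hf0, hf⟩ := Submodule.exists_le_ker_of_lt_top _ (lt_top_iff_ne_top.2 hne)
  refine h ⟨AffineSubspace.mk' c (LinearMap.ker f), ?_, fun x hx => ?_⟩
  · rw [AffineSubspace.direction_mk']
    have h1 := f.finrank_range_add_finrank_ker
    rw [LinearMap.range_eq_top.2 (LinearMap.surjective hf0)] at h1
    simp only [finrank_top, Module.finrank_self, finrank_euclideanSpace, Fintype.card_fin] at h1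
    omega
  · change x ∈ AffineSubspace.mk' c (LinearMap.ker f)
    rw [AffineSubspace.mem_mk']
    exact hf (Submodule.subset_span ⟨x, hx, rfl⟩)

/-- The group generated by the differences is discrete, being contained in Λ, and spans the space by
nondegeneracy. It is therefore itself a lattice, and minimality of Λ gives equality. -/
theorem IsMainLattice.exists_eq_span {μ : Measure (EuclideanSpace ℝ (Fin d))}
    {Λ : Submodule ℤ (EuclideanSpace ℝ (Fin d))} (hΛ : IsMainLattice μ Λ)
    (hμ : IsNondegenerate μ) :
    ∃ c ∈ μ.support, Λ = Submodule.span ℤ ((fun x => x - c) '' μ.support) := by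
  obtain ⟨c, hc, ⟨hL, hmem⟩, hmin⟩ := hΛ
  have hle : Submodule.span ℤ ((fun x => x - c) '' μ.support) ≤ Λ := by
    rw [Submodule.span_le]
    rintro _ ⟨x, hx, rfl⟩
    exact hmem x hx
  refine ⟨c, hc, le_antisymm (hmin ⟨?_, fun x hx => Submodule.subset_span ⟨x, hx, rfl⟩⟩) hle⟩
  have := hL.discreteTopology
  have : DiscreteTopology (Submodule.span ℤ ((fun x => x - c) '' μ.support)) :=
    DiscreteTopology.of_subset (s := (Λ : Set (EuclideanSpace ℝ (Fin d)))) ‹_› hle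
  refine isLattice_of_discrete_of_span (top_le_iff.1 ?_)
  rw [← hμ.span_sub_eq_top c]
  exact Submodule.span_mono Submodule.subset_span

theorem IsMainLattice.exists_ae_sub_mem {μ : Measure (EuclideanSpace ℝ (Fin d))}
    {Λ : Submodule ℤ (EuclideanSpace ℝ (Fin d))} (hΛ : IsMainLattice μ Λ) :
    ∃ c, ∀ᵐ x ∂μ, x - c ∈ Λ := by
  obtain ⟨c, -, ⟨-, hmem⟩, -⟩ := hΛ
  exact ⟨c, by filter_upwards [μ.support_mem_ae] with x hx using hmem x hx⟩

theorem exists_forall_norm_lt_eq_zero {E : Type*} [NormedAddCommGroup E] (Λ : Submodule ℤ E)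
    [DiscreteTopology Λ] : ∃ r > 0, ∀ w ∈ Λ, ‖w‖ < r → w = 0 := by
  obtain ⟨r, hr, h⟩ := Metric.isOpen_iff.1 (isOpen_discrete ({0} : Set Λ)) 0 rfl
  refine ⟨r, hr, fun w hw hwr => ?_⟩
  have : (⟨w, hw⟩ : Λ) ∈ ({0} : Set Λ) := h (by simpa [Subtype.dist_eq] using hwr)
  simpa using this

end MainLattice

/-! ### Control of characters by the characteristic functions -/

section ControlsCharacter

variable {E : Type*} [NormedAddCommGroup E] [InnerProductSpace ℝ E]

/-- The linear map sending a frequency to its pairings with a basis. -/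
noncomputable def pairing {d : ℕ} (b : Module.Basis (Fin d) ℝ E) : E →ₗ[ℝ] (Fin d → ℝ) :=
  LinearMap.pi fun j => innerₗ E (b j)

@[simp]
theorem pairing_apply {d : ℕ} (b : Module.Basis (Fin d) ℝ E) (t : E) (j : Fin d) :
    pairing b t j = inner ℝ (b j) t := rfl

theorem ker_pairing {d : ℕ} (b : Module.Basis (Fin d) ℝ E) : LinearMap.ker (pairing b) = ⊥ := by
  rw [LinearMap.ker_eq_bot']
  intro t ht
  refine InnerProductSpace.ext_inner_left_basis b fun j => ?_
  simpa using congrFun ht j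

variable [MeasurableSpace E]

/-- The characteristic functions of the laws `μ i` eventually control the deviation from `1` of
the character attached to `v`. -/
def ControlsCharacter {ι : Type*} (μ : ι → Measure E) (l : Filter ι) (v : E) : Prop :=
  ∃ C : ℝ, 0 ≤ C ∧ ∀ᶠ i in l, ∀ t,
    1 - Real.cos (inner ℝ v t) ≤ C * (1 - ‖charFun (μ i) t‖ ^ 2)

/-- Since 1 - cos x = 2 sin²(x/2), the addition formula and (p + q)² ≤ 2p² + 2q² give the bound. It
makes the controlled vectors a subgroup. -/
theorem one_sub_cos_add_le (a b : ℝ) :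
    1 - Real.cos (a + b) ≤ 2 * (1 - Real.cos a) + 2 * (1 - Real.cos b) := by
  have key (x : ℝ) : 1 - Real.cos x = 2 * Real.sin (x / 2) ^ 2 := by
    rw [Real.sin_sq_eq_half_sub]
    ring_nf
  rw [key, key a, key b, add_div, Real.sin_add]
  have ha := Real.sin_sq_add_cos_sq (a / 2)
  have hb := Real.sin_sq_add_cos_sq (b / 2)
  nlinarith [sq_nonneg (Real.sin (a / 2) * Real.cos (b / 2) - Real.cos (a / 2) * Real.sin (b / 2)),
    sq_nonneg (Real.sin (a / 2) * Real.sin (b / 2))]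

theorem ControlsCharacter.add {ι : Type*} {μ : ι → Measure E} {l : Filter ι} {v w : E}
    (hv : ControlsCharacter μ l v) (hw : ControlsCharacter μ l w) :
    ControlsCharacter μ l (v + w) := by
  obtain ⟨C, hC, hv⟩ := hv
  obtain ⟨D, hD, hw⟩ := hw
  refine ⟨2 * C + 2 * D, by positivity, ?_⟩
  filter_upwards [hv, hw] with i hi hi' t
  rw [inner_add_left]
  linarith [one_sub_cos_add_le (inner ℝ v t) (inner ℝ w t), hi t, hi' t]

theorem ControlsCharacter.neg {ι : Type*} {μ : ι → Measure E} {l : Filter ι} {v : E}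
    (hv : ControlsCharacter μ l v) : ControlsCharacter μ l (-v) := by
  simpa [ControlsCharacter, inner_neg_left] using hv

theorem controlsCharacter_zero {ι : Type*} {μ : ι → Measure E} {l : Filter ι} :
    ControlsCharacter μ l 0 := ⟨0, le_rfl, by simp⟩

theorem controlsCharacter_of_mem_span {ι : Type*} {μ : ι → Measure E} {l : Filter ι} {s : Set E}
    (hs : ∀ v ∈ s, ControlsCharacter μ l v) {v : E} (hv : v ∈ Submodule.span ℤ s) :
    ControlsCharacter μ l v := by
  rw [← Submodule.mem_toAddSubgroup, Submodule.span_int_eq_addSubgroupClosure] at hv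
  induction hv using AddSubgroup.closure_induction with
  | mem x hx => exact hs x hx
  | zero => exact controlsCharacter_zero
  | add x y _ _ hx hy => exact hx.add hy
  | neg x _ hx => exact hx.neg

/-- For |s| ≤ π one has 1 - cos s ≥ (2/π²)s², so control of each b_j bounds every ⟨b_j, t⟩², and
hence ‖t‖² by injectivity of the pairing, by a multiple of 1 - |φ(t)|². The inequality 1 - x ≤
exp(-x) finishes. -/
theorem exists_eventually_norm_charFun_le [FiniteDimensional ℝ E] {ι : Type*}
    {μ : ι → Measure E}
    [∀ i, IsProbabilityMeasure (μ i)] {l : Filter ι} {d : ℕ} (b : Module.Basis (Fin d) ℝ E)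
    (hb : ∀ j, ControlsCharacter μ l (b j)) :
    ∃ a > 0, ∀ᶠ i in l, ∀ t, (∀ j, |inner ℝ (b j) t| ≤ Real.pi) →
      ‖charFun (μ i) t‖ ≤ Real.exp (-a * ‖t‖ ^ 2) := by
  choose C hC h using hb
  obtain ⟨K, hK, hanti⟩ := (pairing b).exists_antilipschitzWith (ker_pairing b)
  have hKr : (0 : ℝ) < K := hK
  -- The summand 1 keeps `D` positive even if all the `C j` vanish.
  set D : ℝ := 1 + ∑ j, C j with hD
  have hD0 : 0 < D := by
    have := Finset.sum_nonneg fun j (_ : j ∈ Finset.univ) => hC j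
    positivity
  -- The estimate concerns |φ|², so passing to |φ| halves the exponent.
  refine ⟨(K ^ 2 * (Real.pi ^ 2 / 2) * D)⁻¹ / 2, by positivity, ?_⟩
  filter_upwards [eventually_all.2 h] with i hi t ht
  have hφ : 0 ≤ 1 - ‖charFun (μ i) t‖ ^ 2 :=
    sub_nonneg.2 (pow_le_one₀ (norm_nonneg _) (norm_charFun_le_one t))
  have h1 : ‖t‖ ≤ K * ‖pairing b t‖ := by
    simpa using hanti.le_mul_dist t 0
  have h2 : ‖pairing b t‖ ^ 2 ≤ (Real.pi ^ 2 / 2) * D * (1 - ‖charFun (μ i) t‖ ^ 2) := by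
    have hsq : ‖pairing b t‖ ≤
        Real.sqrt ((Real.pi ^ 2 / 2) * D * (1 - ‖charFun (μ i) t‖ ^ 2)) := by
      refine (pi_norm_le_iff_of_nonneg (Real.sqrt_nonneg _)).2 fun j => ?_
      refine Real.le_sqrt_of_sq_le ?_
      rw [Real.norm_eq_abs, sq_abs, pairing_apply]
      have hc := Real.cos_le_one_sub_mul_cos_sq (ht j)
      have h3 : 2 / Real.pi ^ 2 * (inner ℝ (b j) t) ^ 2 ≤
          D * (1 - ‖charFun (μ i) t‖ ^ 2) := by
        have hCD : C j ≤ D := by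
          have := Finset.single_le_sum (fun j _ => hC j) (Finset.mem_univ j)
          linarith
        calc 2 / Real.pi ^ 2 * (inner ℝ (b j) t) ^ 2 ≤ 1 - Real.cos (inner ℝ (b j) t) := by
              linarith
          _ ≤ C j * (1 - ‖charFun (μ i) t‖ ^ 2) := hi j t
          _ ≤ _ := by gcongr
      calc (inner ℝ (b j) t) ^ 2
          = Real.pi ^ 2 / 2 * (2 / Real.pi ^ 2 * (inner ℝ (b j) t) ^ 2) := by
            field_simp
        _ ≤ Real.pi ^ 2 / 2 * (D * (1 - ‖charFun (μ i) t‖ ^ 2)) := by gcongr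
        _ = _ := by ring
    calc ‖pairing b t‖ ^ 2 ≤ _ := pow_le_pow_left₀ (norm_nonneg _) hsq 2
      _ = _ := Real.sq_sqrt (by positivity)
  have h4 : ‖t‖ ^ 2 ≤ K ^ 2 * (Real.pi ^ 2 / 2) * D * (1 - ‖charFun (μ i) t‖ ^ 2) := by
    calc ‖t‖ ^ 2 ≤ (K * ‖pairing b t‖) ^ 2 := pow_le_pow_left₀ (norm_nonneg _) h1 2
      _ = K ^ 2 * ‖pairing b t‖ ^ 2 := by ring
      _ ≤ K ^ 2 * ((Real.pi ^ 2 / 2) * D * (1 - ‖charFun (μ i) t‖ ^ 2)) := by gcongr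
      _ = _ := by ring
  have h5 : ‖charFun (μ i) t‖ ^ 2 ≤ 1 - (K ^ 2 * (Real.pi ^ 2 / 2) * D)⁻¹ * ‖t‖ ^ 2 := by
    have : (K ^ 2 * (Real.pi ^ 2 / 2) * D)⁻¹ * ‖t‖ ^ 2 ≤ 1 - ‖charFun (μ i) t‖ ^ 2 := by
      rw [inv_mul_le_iff₀ (by positivity)]
      exact h4
    linarith
  refine le_of_sq_le_sq ?_ (Real.exp_pos _).le
  rw [← Real.exp_nat_mul]
  refine h5.trans ((Real.one_sub_le_exp_neg _).trans_eq ?_)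
  congr 1
  push_cast
  ring

end ControlsCharacter

/-- A ball around a support point has positive limiting mass, and the portmanteau inequality for
open sets keeps any smaller `η` as an eventual lower bound. -/
theorem exists_eventually_le_measureReal_ball {E : Type*} [NormedAddCommGroup E]
    [MeasurableSpace E] [BorelSpace E] {ι : Type*} {l : Filter ι}
    {μ : ι → ProbabilityMeasure E} {μ₀ : ProbabilityMeasure E} (hlim : Tendsto μ l (𝓝 μ₀))
    {x : E} (hx : x ∈ (μ₀ : Measure E).support) {r : ℝ} (hr : 0 < r) :
    ∃ η > 0, ∀ᶠ i in l, η ≤ (μ i : Measure E).real (Metric.ball x r) := by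
  have hpos : 0 < (μ₀ : Measure E) (Metric.ball x r) :=
    (Measure.mem_support_iff_forall x).1 hx _ (Metric.ball_mem_nhds x hr)
  obtain ⟨η, hη0, hη⟩ := exists_between hpos
  have hη_top : η ≠ ∞ := (hη.trans_le le_top).ne
  refine ⟨η.toReal, ENNReal.toReal_pos hη0.ne' hη_top, ?_⟩
  have h1 := hη.trans_le
    (ProbabilityMeasure.le_liminf_measure_open_of_tendsto hlim (Metric.isOpen_ball (x := x) (ε := r)))
  filter_upwards [eventually_lt_of_lt_liminf h1] with i hi
  exact ENNReal.toReal_mono (measure_ne_top _ _) hi.le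

/-! ### Symmetrisation and lower bounds for 1 - |φ|² -/

section CharFunDecay

variable {E : Type*} [NormedAddCommGroup E] [InnerProductSpace ℝ E] [MeasurableSpace E]
  [BorelSpace E] [SecondCountableTopology E]

/-- |φ|² is the characteristic function of the difference of two independent copies; take real
parts. -/
theorem one_sub_norm_sq_charFun (μ : Measure E) [IsProbabilityMeasure μ] (t : E) :
    1 - ‖charFun μ t‖ ^ 2 = ∫ p : E × E, (1 - Real.cos (inner ℝ (p.1 - p.2) t)) ∂(μ.prod μ) := by
  have hcos : Integrable (fun p : E × E => Real.cos (inner ℝ (p.1 - p.2) t)) (μ.prod μ) :=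
    Integrable.of_bound (by fun_prop) 1 (ae_of_all _ fun p => Real.abs_cos_le_one _)
  have h1 : ((‖charFun μ t‖ ^ 2 : ℝ) : ℂ) =
      ∫ p : E × E, Complex.exp ((inner ℝ (p.1 - p.2) t : ℝ) * Complex.I) ∂(μ.prod μ) := by
    have := Complex.mul_conj (charFun μ t)
    rw [Complex.normSq_eq_norm_sq] at this
    rw [← this, ← charFun_neg, charFun_apply, charFun_apply, ← integral_prod_mul]
    refine integral_congr_ae (ae_of_all _ fun p => ?_)
    simp only [← Complex.exp_add, inner_sub_left, inner_neg_right]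
    congr 1
    push_cast
    ring
  have hexp : Integrable (fun p : E × E =>
      Complex.exp ((inner ℝ (p.1 - p.2) t : ℝ) * Complex.I)) (μ.prod μ) :=
    Integrable.of_bound (by fun_prop) 1
      (ae_of_all _ fun p => (Complex.norm_exp_ofReal_mul_I _).le)
  have h2 := congrArg Complex.re h1
  rw [Complex.ofReal_re] at h2
  have h3 := integral_re hexp
  simp only [RCLike.re_to_complex] at h3
  rw [h2, ← h3, integral_sub (integrable_const _) hcos]
  simp [Complex.exp_ofReal_mul_I_re]

/-- The symmetrised integrand is nonnegative, so it may be restricted to `A ×ˢ B`, where it is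
constant. -/
theorem measureReal_mul_one_sub_cos_le (μ : Measure E) [IsProbabilityMeasure μ] {A B : Set E}
    (hA : MeasurableSet A) (hB : MeasurableSet B) {v : E}
    (h : ∀ᵐ p ∂(μ.prod μ), p ∈ A ×ˢ B → p.1 - p.2 = v) (t : E) :
    μ.real A * μ.real B * (1 - Real.cos (inner ℝ v t)) ≤ 1 - ‖charFun μ t‖ ^ 2 := by
  have hcos : Integrable (fun p : E × E => 1 - Real.cos (inner ℝ (p.1 - p.2) t)) (μ.prod μ) :=
    (integrable_const _).sub
      (Integrable.of_bound (by fun_prop) 1 (ae_of_all _ fun p => Real.abs_cos_le_one _))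
  rw [one_sub_norm_sq_charFun]
  calc μ.real A * μ.real B * (1 - Real.cos (inner ℝ v t))
      = ∫ _p in A ×ˢ B, (1 - Real.cos (inner ℝ v t)) ∂(μ.prod μ) := by
        rw [setIntegral_const, measureReal_prod_prod, smul_eq_mul]
    _ = ∫ p in A ×ˢ B, (1 - Real.cos (inner ℝ (p.1 - p.2) t)) ∂(μ.prod μ) :=
        setIntegral_congr_ae (hA.prod hB) (h.mono fun p hp hpAB => by rw [hp hpAB])
    _ ≤ _ := setIntegral_le_integral hcos
        (ae_of_all _ fun p => by simpa using Real.cos_le_one _)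

/-- Two samples within r/2 of x and y have a difference within r of x - y. Both differences lie in
Λ, which has no nonzero vector shorter than r, so they coincide. This event has probability at least
η₁η₂. -/
theorem controlsCharacter_sub_of_mem_support {ι : Type*} {l : Filter ι}
    {μ : ι → ProbabilityMeasure E} {μ₀ : ProbabilityMeasure E} (hlim : Tendsto μ l (𝓝 μ₀))
    {Λ : Submodule ℤ E} [DiscreteTopology Λ] (hΛ : ∀ i, ∃ c, ∀ᵐ x ∂(μ i : Measure E), x - c ∈ Λ)
    {x y : E} (hx : x ∈ (μ₀ : Measure E).support) (hy : y ∈ (μ₀ : Measure E).support)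
    (hxy : x - y ∈ Λ) :
    ControlsCharacter (fun i => (μ i : Measure E)) l (x - y) := by
  obtain ⟨r, hr, hrΛ⟩ := exists_forall_norm_lt_eq_zero Λ
  obtain ⟨η₁, hη₁, h₁⟩ := exists_eventually_le_measureReal_ball hlim hx (half_pos hr)
  obtain ⟨η₂, hη₂, h₂⟩ := exists_eventually_le_measureReal_ball hlim hy (half_pos hr)
  refine ⟨(η₁ * η₂)⁻¹, by positivity, ?_⟩
  filter_upwards [h₁, h₂] with i hi₁ hi₂ t
  obtain ⟨c, hc⟩ := hΛ i
  have hae : ∀ᵐ p ∂((μ i : Measure E).prod (μ i : Measure E)),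
      p ∈ Metric.ball x (r / 2) ×ˢ Metric.ball y (r / 2) → p.1 - p.2 = x - y := by
    filter_upwards [Measure.quasiMeasurePreserving_fst.ae hc,
      Measure.quasiMeasurePreserving_snd.ae hc] with p hp₁ hp₂ hp
    have hmem : (p.1 - p.2) - (x - y) ∈ Λ := by
      have := Λ.sub_mem (Λ.sub_mem hp₁ hp₂) hxy
      rwa [sub_sub_sub_cancel_right] at this
    refine sub_eq_zero.1 (hrΛ _ hmem ?_)
    have h1 : ‖p.1 - x‖ < r / 2 := by simpa [dist_eq_norm] using hp.1
    have h2 : ‖p.2 - y‖ < r / 2 := by simpa [dist_eq_norm] using hp.2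
    calc ‖(p.1 - p.2) - (x - y)‖ = ‖(p.1 - x) - (p.2 - y)‖ := by congr 1; abel
      _ ≤ ‖p.1 - x‖ + ‖p.2 - y‖ := norm_sub_le _ _
      _ < r := by linarith
  have h := measureReal_mul_one_sub_cos_le (μ i : Measure E) Metric.isOpen_ball.measurableSet
    Metric.isOpen_ball.measurableSet hae t
  rw [inv_mul_eq_div, le_div_iff₀ (by positivity), mul_comm]
  refine le_trans ?_ h
  have : 0 ≤ 1 - Real.cos (inner ℝ (x - y) t) := sub_nonneg.2 (Real.cos_le_one _)
  gcongr

end CharFunDecay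

/-! ### Fourier inversion on the dual cell -/

section Inversion

variable {d : ℕ}

theorem integral_comp_mulVec {B : Matrix (Fin d) (Fin d) ℝ} (hB : B.det ≠ 0)
    (G : (Fin d → ℝ) → ℂ) :
    ∫ t : EuclideanSpace ℝ (Fin d), G (B.mulVec (WithLp.ofLp t)) =
      |B.det|⁻¹ • ∫ s, G s := by
  have h1 : ∫ t : EuclideanSpace ℝ (Fin d), G (B.mulVec (WithLp.ofLp t)) =
      ∫ s : Fin d → ℝ, G (B.mulVec s) :=
    (PiLp.volume_preserving_ofLp (Fin d)).integral_comp
      (MeasurableEquiv.toLp 2 (Fin d → ℝ)).symm.measurableEmbedding (fun s => G (B.mulVec s))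
  have hdet : LinearMap.det (Matrix.toLin' B) ≠ 0 := by rwa [LinearMap.det_toLin']
  let e : (Fin d → ℝ) ≃L[ℝ] (Fin d → ℝ) :=
    (LinearEquiv.ofIsUnitDet (f := Matrix.toLin' B)
      (v := Pi.basisFun ℝ (Fin d)) (v' := Pi.basisFun ℝ (Fin d))
      (by simpa [LinearMap.toMatrix_eq_toMatrix'] using hB)).toContinuousLinearEquiv
  have he (s : Fin d → ℝ) : e s = B.mulVec s := by
    change Matrix.toLin' B s = _
    simp
  have h2 := Real.map_matrix_volume_pi_eq_smul_volume_pi hB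
  have h3 : ∫ s, G s ∂(Measure.map (Matrix.toLin' B) volume) = ∫ s : Fin d → ℝ, G (B.mulVec s) := by
    have := e.toHomeomorph.measurableEmbedding.integral_map (μ := volume) G
    have hfun : (e.toHomeomorph : (Fin d → ℝ) → Fin d → ℝ) = Matrix.toLin' B := by
      ext1 s
      simpa using he s
    rw [hfun] at this
    simpa using this
  rw [h1, ← h3, h2, integral_smul_measure, ENNReal.toReal_ofReal (abs_nonneg _), abs_inv]

theorem integral_Icc_exp_int_mul (k : ℤ) :
    ∫ s in Set.Icc (-Real.pi) Real.pi, Complex.exp (k * s * Complex.I) =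
      if k = 0 then (2 * Real.pi : ℂ) else 0 := by
  rw [integral_Icc_eq_integral_Ioc, ← intervalIntegral.integral_of_le (by linarith [Real.pi_pos])]
  split_ifs with hk
  · simp [hk, two_mul]
  · have hk' : (k * Complex.I : ℂ) ≠ 0 := by simp [hk]
    have h1 := integral_exp_mul_complex (a := -Real.pi) (b := Real.pi) hk'
    simp_rw [mul_right_comm (k : ℂ) _ Complex.I]
    rw [h1]
    have : Complex.exp (k * Complex.I * (Real.pi : ℂ)) =
        Complex.exp (k * Complex.I * ((-Real.pi : ℝ) : ℂ)) := by
      rw [Complex.exp_eq_exp_iff_exists_int]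
      refine ⟨k, ?_⟩
      push_cast
      ring
    rw [this, sub_self, zero_div]

/-- The fundamental cell of the lattice of frequencies dual to a basis `b`. -/
def dualCell {E : Type*} [NormedAddCommGroup E] [InnerProductSpace ℝ E]
    (b : Module.Basis (Fin d) ℝ E) : Set E :=
  {t | ∀ j, |inner ℝ (b j) t| ≤ Real.pi}

theorem isClosed_dualCell {E : Type*} [NormedAddCommGroup E] [InnerProductSpace ℝ E]
    (b : Module.Basis (Fin d) ℝ E) : IsClosed (dualCell b) := by
  simp only [dualCell, Set.ofPred_forall]
  exact isClosed_iInter fun j => isClosed_le (by fun_prop) continuous_const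

theorem isCompact_dualCell {E : Type*} [NormedAddCommGroup E] [InnerProductSpace ℝ E]
    [FiniteDimensional ℝ E] (b : Module.Basis (Fin d) ℝ E) : IsCompact (dualCell b) := by
  have := FiniteDimensional.proper_real E
  obtain ⟨K, -, hanti⟩ := (pairing b).exists_antilipschitzWith (ker_pairing b)
  refine Metric.isCompact_of_isClosed_isBounded (isClosed_dualCell b)
    ((Metric.isBounded_closedBall (x := (0 : E)) (r := K * Real.pi)).subset fun t ht => ?_)
  have h1 : ‖t‖ ≤ K * ‖pairing b t‖ := by simpa using hanti.le_mul_dist t 0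
  rw [mem_closedBall_zero_iff]
  refine h1.trans ?_
  gcongr
  exact (pi_norm_le_iff_of_nonneg Real.pi_pos.le).2 ht

theorem det_coord_ne_zero (b : Module.Basis (Fin d) ℝ (EuclideanSpace ℝ (Fin d))) :
    (Matrix.of fun j i => b j i : Matrix (Fin d) (Fin d) ℝ).det ≠ 0 := by
  have h := ZLattice.covolume_ne_zero (Submodule.span ℤ (Set.range b)) volume
  have h2 := latticeDet_eq_abs_det b
  rw [latticeDet] at h2
  rw [h2, abs_ne_zero, ← Matrix.det_transpose] at h
  exact h

theorem latticeDet_pos (b : Module.Basis (Fin d) ℝ (EuclideanSpace ℝ (Fin d))) :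
    0 < latticeDet (Submodule.span ℤ (Set.range b)) :=
  ZLattice.covolume_pos _ _

/-- The pairing has the matrix with rows b_j, so its Jacobian is det(Λ); this is the source of that
factor in the theorem. -/
theorem integral_comp_pairing (b : Module.Basis (Fin d) ℝ (EuclideanSpace ℝ (Fin d)))
    (G : (Fin d → ℝ) → ℂ) :
    ∫ t, G (pairing b t) = (latticeDet (Submodule.span ℤ (Set.range b)))⁻¹ • ∫ s, G s := by
  rw [latticeDet_eq_abs_det, ← Matrix.det_transpose]
  have := integral_comp_mulVec (det_coord_ne_zero b) G
  refine Eq.trans (integral_congr_ae (ae_of_all _ fun t => ?_)) this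
  simp only
  congr 1
  ext j
  simp [Matrix.mulVec, dotProduct, PiLp.inner_apply, mul_comm]

/-- Orthogonality of the characters of a lattice on the dual cell. -/
theorem setIntegral_dualCell_exp (b : Module.Basis (Fin d) ℝ (EuclideanSpace ℝ (Fin d)))
    {v : EuclideanSpace ℝ (Fin d)} (hv : v ∈ Submodule.span ℤ (Set.range b)) :
    ∫ t in dualCell b, Complex.exp ((inner ℝ v t : ℝ) * Complex.I) =
      if v = 0 then ((2 * Real.pi) ^ d / latticeDet (Submodule.span ℤ (Set.range b)) : ℂ)
      else 0 := by
  obtain ⟨k, rfl⟩ : ∃ k : Fin d → ℤ, ∑ j, k j • b j = v :=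
    (Submodule.mem_span_range_iff_exists_fun ℤ).1 hv
  have hzero : (∑ j, k j • b j = 0) ↔ ∀ j, k j = 0 := by
    refine ⟨fun h j => ?_, fun h => by simp [h]⟩
    have h1 : ∑ j, (k j : ℝ) • b j = 0 := by simpa only [Int.cast_smul_eq_zsmul] using h
    exact_mod_cast Fintype.linearIndependent_iff.1 b.linearIndependent _ h1 j
  -- In the coordinates ⟨b_j, t⟩ the dual cell is a cube and the character is a product, so the
  -- integral factorises.
  have hprod (t : EuclideanSpace ℝ (Fin d)) :
      (dualCell b).indicator
        (fun t => Complex.exp ((inner ℝ (∑ j, k j • b j) t : ℝ) * Complex.I)) t =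
      ∏ j, (Set.Icc (-Real.pi) Real.pi).indicator
        (fun s : ℝ => Complex.exp (k j * s * Complex.I)) (pairing b t j) := by
    by_cases ht : t ∈ dualCell b
    · rw [Set.indicator_of_mem ht]
      rw [Finset.prod_congr rfl fun j _ =>
        Set.indicator_of_mem (show pairing b t j ∈ Set.Icc (-Real.pi) Real.pi from
          abs_le.1 (ht j)) _, ← Complex.exp_sum]
      congr 1
      rw [sum_inner, Complex.ofReal_sum, Finset.sum_mul]
      refine Finset.sum_congr rfl fun j _ => ?_
      rw [← Int.cast_smul_eq_zsmul ℝ, real_inner_smul_left]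
      simp
    · rw [Set.indicator_of_notMem ht]
      obtain ⟨j, hj⟩ : ∃ j, ¬ |inner ℝ (b j) t| ≤ Real.pi := by
        simpa [dualCell] using ht
      refine (Finset.prod_eq_zero (Finset.mem_univ j) ?_).symm
      exact Set.indicator_of_notMem (s := Set.Icc (-Real.pi) Real.pi) (fun h => hj (abs_le.2 h)) _
  rw [← integral_indicator (isClosed_dualCell b).measurableSet, integral_congr_ae (ae_of_all _ hprod),
    integral_comp_pairing b (fun s => ∏ j, (Set.Icc (-Real.pi) Real.pi).indicator
        (fun s : ℝ => Complex.exp (k j * s * Complex.I)) (s j)),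
    integral_fintype_prod_volume_eq_prod]
  simp_rw [integral_indicator measurableSet_Icc, integral_Icc_exp_int_mul]
  split_ifs with h
  · rw [hzero] at h
    simp [h, div_eq_inv_mul]
  · obtain ⟨j, hj⟩ := not_forall.1 (mt hzero.2 h)
    rw [Finset.prod_eq_zero (Finset.mem_univ j) (if_neg hj), smul_zero]

/-- Fourier inversion for a law on a coset of a lattice. -/
theorem measureReal_singleton_eq_setIntegral
    (b : Module.Basis (Fin d) ℝ (EuclideanSpace ℝ (Fin d)))
    (ν : Measure (EuclideanSpace ℝ (Fin d))) [IsProbabilityMeasure ν]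
    {y : EuclideanSpace ℝ (Fin d)}
    (hν : ∀ᵐ x ∂ν, x - y ∈ Submodule.span ℤ (Set.range b)) :
    (ν.real {y} : ℂ) = latticeDet (Submodule.span ℤ (Set.range b)) / (2 * Real.pi) ^ d *
      ∫ t in dualCell b, Complex.exp (-(inner ℝ y t : ℝ) * Complex.I) * charFun ν t := by
  have hfin : IsFiniteMeasure (volume.restrict (dualCell b)) :=
    ⟨by simpa using (isCompact_dualCell b).measure_lt_top⟩
  have h1 : ∫ t in dualCell b, Complex.exp (-(inner ℝ y t : ℝ) * Complex.I) * charFun ν t =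
      ∫ t in dualCell b, ∫ x, Complex.exp ((inner ℝ (x - y) t : ℝ) * Complex.I) ∂ν := by
    refine integral_congr_ae (ae_of_all _ fun t => ?_)
    simp only [charFun_apply]
    rw [← integral_const_mul]
    refine integral_congr_ae (ae_of_all _ fun x => ?_)
    simp only [← Complex.exp_add, inner_sub_left]
    congr 1
    push_cast
    ring
  have h2 : ∫ t in dualCell b, ∫ x, Complex.exp ((inner ℝ (x - y) t : ℝ) * Complex.I) ∂ν =
      ∫ x, (∫ t in dualCell b, Complex.exp ((inner ℝ (x - y) t : ℝ) * Complex.I)) ∂ν := by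
    refine integral_integral_swap (f := fun t x : EuclideanSpace ℝ (Fin d) =>
      Complex.exp ((inner ℝ (x - y) t : ℝ) * Complex.I)) (Integrable.of_bound
      (by unfold Function.uncurry; fun_prop) 1 (ae_of_all _ fun p => ?_))
    exact (Complex.norm_exp_ofReal_mul_I _).le
  have hD : (latticeDet (Submodule.span ℤ (Set.range b)) : ℂ) ≠ 0 := by
    exact_mod_cast (latticeDet_pos b).ne'
  -- By orthogonality the inner integral vanishes unless x = y, so only the atom at y survives.
  have h3 : ∫ x, (∫ t in dualCell b, Complex.exp ((inner ℝ (x - y) t : ℝ) * Complex.I)) ∂ν =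
      ν.real {y} * ((2 * Real.pi) ^ d / latticeDet (Submodule.span ℤ (Set.range b)) : ℂ) := by
    have : ∫ x, (∫ t in dualCell b, Complex.exp ((inner ℝ (x - y) t : ℝ) * Complex.I)) ∂ν =
        ∫ x, ({y} : Set _).indicator (fun _ =>
          ((2 * Real.pi) ^ d / latticeDet (Submodule.span ℤ (Set.range b)) : ℂ)) x ∂ν := by
      refine integral_congr_ae ?_
      filter_upwards [hν] with x hx
      rw [setIntegral_dualCell_exp b hx]
      simp [Set.indicator_apply, sub_eq_zero]
    rw [this, integral_indicator_const _ (measurableSet_singleton y)]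
    simp
  have hpi : ((2 * Real.pi : ℂ)) ^ d ≠ 0 := pow_ne_zero _ (by simp [Real.pi_ne_zero])
  rw [h1, h2, h3]
  field_simp

end Inversion

/-! ### The Gaussian density as an inverse Fourier transform -/

section GaussianDensity

variable {d : ℕ}

open scoped Matrix MatrixOrder Matrix.Norms.L2Operator in
/-- The density of a centred normal law is the inverse Fourier transform of its characteristic
function. -/
theorem integral_exp_quadratic_eq_gaussianDensity {S : Matrix (Fin d) (Fin d) ℝ} (hS : S.PosDef)
    (z : EuclideanSpace ℝ (Fin d)) :
    ∫ u : EuclideanSpace ℝ (Fin d), Complex.exp (-(inner ℝ z u : ℝ) * Complex.I) *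
      Complex.exp (-(WithLp.ofLp u ⬝ᵥ S *ᵥ WithLp.ofLp u : ℝ) / 2) =
      ((2 * Real.pi) ^ d * gaussianDensity S z : ℝ) := by
  -- With S = MᵀM, the substitution s = Mu reduces the quadratic form to |s|². The vector `w` below
  -- satisfies ⟨z, u⟩ = w·Mu and w·w = z·S⁻¹z.
  obtain ⟨M, hM⟩ := CStarAlgebra.nonneg_iff_eq_star_mul_self.1 hS.posSemidef.nonneg
  rw [Matrix.star_eq_conjTranspose, Matrix.conjTranspose_eq_transpose_of_trivial] at hM
  have hdetS : S.det = M.det ^ 2 := by rw [hM, Matrix.det_mul, Matrix.det_transpose, sq]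
  have hdetM : M.det ≠ 0 := by
    intro h
    have := hS.det_pos
    rw [hdetS, h] at this
    simp at this
  have hMu : IsUnit M.det := isUnit_iff_ne_zero.2 hdetM
  set w : Fin d → ℝ := Mᵀ⁻¹ *ᵥ WithLp.ofLp z with hw
  have hlin (u : EuclideanSpace ℝ (Fin d)) : inner ℝ z u = w ⬝ᵥ M *ᵥ WithLp.ofLp u := by
    rw [Matrix.dotProduct_mulVec, ← Matrix.mulVec_transpose, hw, Matrix.mulVec_mulVec,
      Matrix.mul_nonsing_inv _ (by rwa [Matrix.det_transpose]), Matrix.one_mulVec]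
    simp [PiLp.inner_apply, dotProduct, mul_comm]
  have hquad (u : Fin d → ℝ) : u ⬝ᵥ S *ᵥ u = (M *ᵥ u) ⬝ᵥ (M *ᵥ u) := by
    rw [hM, ← Matrix.mulVec_mulVec, Matrix.dotProduct_mulVec, Matrix.vecMul_transpose]
  have hww : w ⬝ᵥ w = WithLp.ofLp z ⬝ᵥ S⁻¹ *ᵥ WithLp.ofLp z := by
    rw [hM, Matrix.mul_inv_rev, ← Matrix.mulVec_mulVec, Matrix.dotProduct_mulVec,
      ← Matrix.mulVec_transpose, Matrix.transpose_nonsing_inv, Matrix.transpose_transpose,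
      dotProduct_comm]
  have h1 := integral_comp_mulVec hdetM (fun s => Complex.exp (-(1 / 2 : ℂ) * ∑ i, (s i : ℂ) ^ 2 +
    ∑ i, (-Complex.I * w i) * s i))
  have h2 := GaussianFourier.integral_cexp_neg_mul_sum_add (ι := Fin d) (b := 1 / 2) (by norm_num)
    (fun i => -Complex.I * w i)
  calc _ = ∫ t : EuclideanSpace ℝ (Fin d), Complex.exp (-(1 / 2 : ℂ) *
        ∑ i, ((M *ᵥ WithLp.ofLp t) i : ℂ) ^ 2 +
          ∑ i, (-Complex.I * w i) * (M *ᵥ WithLp.ofLp t) i) := by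
        refine integral_congr_ae (ae_of_all _ fun u => ?_)
        simp only [← Complex.exp_add]
        congr 1
        rw [hlin, hquad]
        simp only [dotProduct, Complex.ofReal_sum, Complex.ofReal_mul]
        rw [add_comm]
        congr 1
        · simp only [sq]
          ring
        · rw [← Finset.sum_neg_distrib, Finset.sum_mul]
          exact Finset.sum_congr rfl fun i _ => by ring
    _ = |M.det|⁻¹ • ((Real.pi / (1 / 2 : ℂ)) ^ ((Fintype.card (Fin d) : ℂ) / 2) *
          Complex.exp ((∑ i, (-Complex.I * w i) ^ 2) / (4 * (1 / 2)))) := by rw [h1, h2]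
    _ = _ := by
      have e1 : (Real.pi / (1 / 2 : ℂ)) ^ ((Fintype.card (Fin d) : ℂ) / 2) =
          ((Real.sqrt ((2 * Real.pi) ^ d) : ℝ) : ℂ) := by
        rw [Real.sqrt_eq_rpow, ← Real.rpow_natCast_mul (by positivity),
          Complex.ofReal_cpow (by positivity)]
        congr 1
        · push_cast; ring
        · push_cast [Fintype.card_fin]; ring
      have e2 : (∑ i, (-Complex.I * w i) ^ 2) / (4 * (1 / 2) : ℂ) =
          ((-(1 / 2) * (WithLp.ofLp z ⬝ᵥ S⁻¹ *ᵥ WithLp.ofLp z) : ℝ) : ℂ) := by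
        rw [← hww]
        simp only [mul_pow, neg_sq, Complex.I_sq, dotProduct]
        rw [← Finset.mul_sum]
        push_cast
        simp only [← sq]
        ring
      rw [e1, e2, ← Complex.ofReal_exp, ← Complex.ofReal_mul, Complex.real_smul,
        ← Complex.ofReal_mul, gaussianDensity, hdetS,
        Real.sqrt_mul (by positivity), Real.sqrt_sq_eq_abs]
      congr 1
      have h3 : Real.sqrt ((2 * Real.pi) ^ d) ≠ 0 := by positivity
      have h4 : (2 * Real.pi) ^ d = Real.sqrt ((2 * Real.pi) ^ d) * Real.sqrt ((2 * Real.pi) ^ d) :=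
        (Real.mul_self_sqrt (by positivity)).symm
      have h5 : |M.det| ≠ 0 := abs_ne_zero.2 hdetM
      generalize Real.exp _ = e
      conv_rhs => enter [1]; rw [h4]
      field_simp

end GaussianDensity

/-! ### Pointwise convergence of the normalised characteristic functions -/

section PointwiseLimit

/-- The remainder is cubic for small θ and quadratic for large θ. The first bound gives smallness on
balls, the second domination by second moments alone. -/
theorem norm_exp_sub_taylor_two_le (θ : ℝ) :
    ‖Complex.exp (θ * Complex.I) - 1 - θ * Complex.I + θ ^ 2 / 2‖ ≤ 4 * θ ^ 2 * min 1 |θ| := by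
  rcases le_total |θ| 1 with h | h
  · rw [min_eq_right h]
    have h1 : ‖(θ * Complex.I : ℂ)‖ = |θ| := by simp
    have h2 := Complex.exp_bound (x := θ * Complex.I) (by rwa [h1]) (n := 3) (by norm_num)
    simp only [Finset.sum_range_succ, Finset.sum_range_zero, h1] at h2
    have h3 : (θ * Complex.I : ℂ) ^ 2 = -θ ^ 2 := by rw [mul_pow, Complex.I_sq]; ring
    have h4 : Complex.exp (θ * Complex.I) - 1 - θ * Complex.I + θ ^ 2 / 2 =
        Complex.exp (θ * Complex.I) - (0 + (θ * Complex.I) ^ 0 / (Nat.factorial 0 : ℂ) +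
          (θ * Complex.I) ^ 1 / (Nat.factorial 1 : ℂ) +
          (θ * Complex.I) ^ 2 / (Nat.factorial 2 : ℂ)) := by
      rw [h3]
      simp [Nat.factorial]
      ring
    rw [h4]
    refine h2.trans ?_
    have h5 : |θ| ^ 3 = θ ^ 2 * |θ| := by rw [pow_succ, sq_abs]
    rw [h5, mul_comm, mul_assoc 4]
    gcongr
    norm_num [Nat.factorial]
  · rw [min_eq_left h]
    have h1 : ‖Complex.exp (θ * Complex.I)‖ = 1 := Complex.norm_exp_ofReal_mul_I θ
    have h2 : ‖(θ * Complex.I : ℂ)‖ = |θ| := by simp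
    have h3 : ‖(θ ^ 2 / 2 : ℂ)‖ = θ ^ 2 / 2 := by simp
    calc _ ≤ ‖Complex.exp (θ * Complex.I)‖ + ‖(1 : ℂ)‖ + ‖(θ * Complex.I : ℂ)‖ +
          ‖(θ ^ 2 / 2 : ℂ)‖ :=
          (norm_add_le _ _).trans (add_le_add_left ((norm_sub_le _ _).trans
            (add_le_add_left (norm_sub_le _ _) _)) _)
      _ ≤ _ := by
        rw [h1, h2, h3, norm_one, ← sq_abs θ]
        nlinarith

theorem tendsto_one_add_pow_pnat {g : ℕ+ → ℂ} {s : ℂ}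
    (hg : Tendsto (fun n : ℕ+ => ((n : ℕ) : ℂ) * g n) atTop (𝓝 s)) :
    Tendsto (fun n : ℕ+ => (1 + g n) ^ (n : ℕ)) atTop (𝓝 (Complex.exp s)) := by
  have h1 : Tendsto Nat.toPNat' atTop atTop := by
    refine tendsto_atTop_atTop.2 fun b => ⟨b, fun a ha => ?_⟩
    rw [← PNat.coe_le_coe, Nat.toPNat'_coe, if_pos (b.pos.trans_le ha)]
    exact ha
  have h2 : Tendsto (fun k : ℕ => (k : ℂ) * g k.toPNat') atTop (𝓝 s) := by
    refine (hg.comp h1).congr' ?_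
    filter_upwards [eventually_gt_atTop 0] with k hk
    simp [Nat.toPNat'_coe, hk]
  have h3 := (Complex.tendsto_one_add_pow_exp_of_tendsto h2).comp tendsto_PNat_val_atTop_atTop
  refine h3.congr fun n => ?_
  simp

variable {E : Type*} [NormedAddCommGroup E] [InnerProductSpace ℝ E] [MeasurableSpace E]
  [BorelSpace E] [SecondCountableTopology E]

omit [MeasurableSpace E] [BorelSpace E] [SecondCountableTopology E] in
theorem norm_inner_le_quadratic (u x : E) : ‖inner ℝ x u‖ ≤ ‖u‖ * (1 + ‖x‖ ^ 2) := by
  refine (norm_inner_le_norm x u).trans ?_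
  rw [mul_comm]
  gcongr
  nlinarith [sq_nonneg (‖x‖ - 1 / 2)]

omit [MeasurableSpace E] [BorelSpace E] [SecondCountableTopology E] in
theorem norm_inner_sq_le_quadratic (u x : E) :
    ‖(inner ℝ x u) ^ 2‖ ≤ ‖u‖ ^ 2 * (1 + ‖x‖ ^ 2) := by
  rw [norm_pow]
  calc ‖inner ℝ x u‖ ^ 2 ≤ (‖x‖ * ‖u‖) ^ 2 :=
        pow_le_pow_left₀ (norm_nonneg _) (norm_inner_le_norm x u) 2
    _ ≤ _ := by nlinarith [sq_nonneg ‖u‖]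

theorem integrable_inner_of_sq {μ : Measure E} [IsProbabilityMeasure μ]
    (hμ : Integrable (fun x => ‖x‖ ^ 2) μ) (u : E) : Integrable (fun x => inner ℝ x u) μ :=
  integrable_of_quadratic_growth hμ (by fun_prop) (norm_inner_le_quadratic u)

theorem memLp_inner_of_sq {μ : Measure E} [IsProbabilityMeasure μ]
    (hμ : Integrable (fun x => ‖x‖ ^ 2) μ) (u : E) : MemLp (fun x => inner ℝ x u) 2 μ :=
  (memLp_two_iff_integrable_sq (by fun_prop)).2
    (integrable_of_quadratic_growth hμ (by fun_prop) (norm_inner_sq_le_quadratic u))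

theorem tendsto_variance_inner {ι : Type*} {μ : ι → ProbabilityMeasure E}
    {μ₀ : ProbabilityMeasure E} {l : Filter ι} [l.NeBot] [l.IsCountablyGenerated]
    (hlim : Tendsto μ l (𝓝 μ₀)) (h : UniformlySquareIntegrable fun i => (μ i : Measure E))
    (u : E) :
    Tendsto (fun i => Var[fun x => inner ℝ x u; (μ i : Measure E)]) l
      (𝓝 Var[fun x => inner ℝ x u; (μ₀ : Measure E)]) := by
  have h₀ := integrable_norm_sq_of_tendsto hlim h
  simp_rw [fun i => variance_eq_sub (memLp_inner_of_sq (h.1 i) u)]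
  rw [variance_eq_sub (memLp_inner_of_sq h₀ u)]
  refine Tendsto.sub ?_ (Tendsto.pow ?_ 2)
  · exact tendsto_integral_of_quadratic_growth hlim h (by fun_prop) (norm_inner_sq_le_quadratic u)
  · exact tendsto_integral_of_quadratic_growth hlim h (by fun_prop) (norm_inner_le_quadratic u)

/-- Pointwise convergence of the characteristic functions of centred and normalised sums. -/
theorem tendsto_charFun_pow {μ : ℕ+ → ProbabilityMeasure E}
    {μ₀ : ProbabilityMeasure E} (hlim : Tendsto μ atTop (𝓝 μ₀))
    (h : UniformlySquareIntegrable fun i => (μ i : Measure E)) (u : E) :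
    Tendsto (fun n : ℕ+ => (Complex.exp (-((Real.sqrt (n : ℕ))⁻¹ *
        ∫ x, inner ℝ x u ∂(μ n : Measure E) : ℝ) * Complex.I) *
        charFun (μ n : Measure E) ((Real.sqrt (n : ℕ))⁻¹ • u)) ^ (n : ℕ)) atTop
      (𝓝 (Complex.exp (-(Var[fun x => inner ℝ x u; (μ₀ : Measure E)] : ℝ) / 2))) := by
  obtain ⟨M, hM0, hM⟩ := h.exists_integral_le
  set m : ℕ+ → ℝ := fun n => ∫ x, inner ℝ x u ∂(μ n : Measure E) with hm
  have hm_le (n : ℕ+) : |m n| ≤ ‖u‖ * (1 + M) := by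
    have h1 : ‖m n‖ ≤ ∫ x, ‖u‖ * (1 + ‖x‖ ^ 2) ∂(μ n : Measure E) :=
      norm_integral_le_of_norm_le (((integrable_const _).add (h.1 n)).const_mul _)
        (ae_of_all _ (norm_inner_le_quadratic u))
    rw [integral_const_mul, integral_add (integrable_const _) (h.1 n)] at h1
    refine h1.trans ?_
    gcongr
    · simp
    · exact hM n
  set A : ℝ := ‖u‖ * (1 + M) with hA
  have hA0 : 0 ≤ A := by positivity
  have hw_le (n : ℕ+) (x : E) : |inner ℝ x u - m n| ≤ A * (1 + ‖x‖) := by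
    have h1 : |inner ℝ x u| ≤ ‖x‖ * ‖u‖ := abs_real_inner_le_norm x u
    have h2 : ‖x‖ * ‖u‖ ≤ A * ‖x‖ := by
      rw [mul_comm, hA]
      gcongr
      nlinarith [norm_nonneg u]
    calc |inner ℝ x u - m n| ≤ |inner ℝ x u| + |m n| := abs_sub _ _
      _ ≤ A * (1 + ‖x‖) := by linarith [hm_le n]
  have hsn (n : ℕ+) : 0 < Real.sqrt (n : ℕ) := Real.sqrt_pos.2 (by exact_mod_cast n.pos)
  set θ : ℕ+ → E → ℝ := fun n x => (Real.sqrt (n : ℕ))⁻¹ * (inner ℝ x u - m n) with hθ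
  have hnθ (n : ℕ+) (x : E) : ((n : ℕ) : ℝ) * θ n x ^ 2 = (inner ℝ x u - m n) ^ 2 := by
    rw [hθ]
    simp only [mul_pow, inv_pow]
    rw [Real.sq_sqrt (by positivity), mul_inv_cancel_left₀ (by simp)]
  -- `g n` is n times the second-order Taylor remainder. As `θ n` is centred, the linear term
  -- integrates to zero and n(ψ - 1) = ∫ g - Var/2, where ψ is the centred characteristic function
  -- at u/√n.
  set g : ℕ+ → E → ℂ := fun n x => ((n : ℕ) : ℂ) *
    (Complex.exp (θ n x * Complex.I) - 1 - θ n x * Complex.I + (θ n x) ^ 2 / 2) with hg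
  have hg_le (n : ℕ+) (x : E) :
      ‖g n x‖ ≤ 4 * (inner ℝ x u - m n) ^ 2 * min 1 |θ n x| := by
    rw [hg]
    simp only [norm_mul, Complex.norm_natCast]
    calc _ ≤ ((n : ℕ) : ℝ) * (4 * θ n x ^ 2 * min 1 |θ n x|) := by
          gcongr
          exact norm_exp_sub_taylor_two_le _
      _ = 4 * (((n : ℕ) : ℝ) * θ n x ^ 2) * min 1 |θ n x| := by ring
      _ = _ := by rw [hnθ]
  have hg0 : Tendsto (fun n => ∫ x, g n x ∂(μ n : Measure E)) atTop (𝓝 0) := by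
    -- The constant 8A² comes from 4A²(1 + r)² ≤ 8A²(1 + r²). On a ball, `θ n` is of order 1/√n.
    refine h.tendsto_integral_zero (C := 8 * A ^ 2) (fun n x => ?_) (fun R ε hε => ?_)
    · calc ‖g n x‖ ≤ 4 * (inner ℝ x u - m n) ^ 2 * min 1 |θ n x| := hg_le n x
        _ ≤ 4 * (inner ℝ x u - m n) ^ 2 * 1 := by gcongr; exact min_le_left _ _
        _ ≤ 4 * (A * (1 + ‖x‖)) ^ 2 * 1 := by
          gcongr 4 * ?_ * 1
          rw [← sq_abs]
          exact pow_le_pow_left₀ (abs_nonneg _) (hw_le n x) 2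
        _ ≤ 8 * A ^ 2 * (1 + ‖x‖ ^ 2) := by
          nlinarith [mul_nonneg (sq_nonneg A) (sq_nonneg (1 - ‖x‖))]
    · have hlim0 : Tendsto (fun n : ℕ+ => 4 * (A * (1 + |R|)) ^ 2 *
          ((Real.sqrt (n : ℕ))⁻¹ * (A * (1 + |R|)))) atTop (𝓝 (4 * (A * (1 + |R|)) ^ 2 *
          (0 * (A * (1 + |R|))))) := by
        refine Tendsto.const_mul _ (Tendsto.mul_const _ ?_)
        exact tendsto_inv_atTop_zero.comp (Real.tendsto_sqrt_atTop.comp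
          (tendsto_natCast_atTop_atTop.comp tendsto_PNat_val_atTop_atTop))
      rw [zero_mul, mul_zero] at hlim0
      filter_upwards [hlim0.eventually_le_const hε] with n hn x hx
      have hwK : |inner ℝ x u - m n| ≤ A * (1 + |R|) :=
        (hw_le n x).trans (by gcongr; exact hx.trans (le_abs_self R))
      refine ((hg_le n x).trans ?_).trans hn
      gcongr ?_ * ?_
      · gcongr 4 * ?_
        rw [← sq_abs]
        exact pow_le_pow_left₀ (abs_nonneg _) hwK 2
      · refine (min_le_right _ _).trans ?_
        rw [hθ]
        simp only [abs_mul, abs_inv, abs_of_pos (hsn n)]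
        gcongr
  have hvar : Tendsto (fun n => Var[fun x => inner ℝ x u; (μ n : Measure E)]) atTop
      (𝓝 Var[fun x => inner ℝ x u; (μ₀ : Measure E)]) := tendsto_variance_inner hlim h u
  have hψ (n : ℕ+) : Complex.exp (-((Real.sqrt (n : ℕ))⁻¹ * m n : ℝ) * Complex.I) *
      charFun (μ n : Measure E) ((Real.sqrt (n : ℕ))⁻¹ • u) =
      ∫ x, Complex.exp (θ n x * Complex.I) ∂(μ n : Measure E) := by
    rw [charFun_apply, ← integral_const_mul]
    refine integral_congr_ae (ae_of_all _ fun x => ?_)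
    simp only [← Complex.exp_add, inner_smul_right, hθ]
    congr 1
    push_cast
    ring
  have hmain (n : ℕ+) : ((n : ℕ) : ℂ) *
      (∫ x, Complex.exp (θ n x * Complex.I) ∂(μ n : Measure E) - 1) =
      ∫ x, g n x ∂(μ n : Measure E) -
        (Var[fun x => inner ℝ x u; (μ n : Measure E)] : ℝ) / 2 := by
    have i1 : Integrable (fun x => Complex.exp (θ n x * Complex.I)) (μ n : Measure E) :=
      Integrable.of_bound (by simp only [hθ]; fun_prop) 1
        (ae_of_all _ fun x => (Complex.norm_exp_ofReal_mul_I _).le)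
    have i0 := integrable_inner_of_sq (h.1 n) u
    have i2 : Integrable (fun x => (θ n x : ℂ) * Complex.I) (μ n : Measure E) :=
      (((i0.sub (integrable_const _)).const_mul _).ofReal).mul_const _
    have i3 : Integrable (fun x => (inner ℝ x u - m n) ^ 2) (μ n : Measure E) :=
      ((memLp_inner_of_sq (h.1 n) u).sub (memLp_const (m n))).integrable_sq
    have i4 : Integrable (fun x => (((inner ℝ x u - m n) ^ 2 : ℝ) : ℂ) / 2) (μ n : Measure E) :=
      i3.ofReal.div_const _
    have e2 : ∫ x, (θ n x : ℂ) * Complex.I ∂(μ n : Measure E) = 0 := by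
      rw [integral_mul_const, integral_complex_ofReal]
      simp only [hθ]
      rw [integral_const_mul, integral_sub i0 (integrable_const _)]
      simp [hm]
    have e3 : ∫ x, (((inner ℝ x u - m n) ^ 2 : ℝ) : ℂ) / 2 ∂(μ n : Measure E) =
        (Var[fun x => inner ℝ x u; (μ n : Measure E)] : ℝ) / 2 := by
      rw [integral_div, integral_complex_ofReal, variance_eq_integral (by fun_prop)]
    have eg (x : E) : g n x = ((n : ℕ) : ℂ) *
        (Complex.exp (θ n x * Complex.I) - 1 - θ n x * Complex.I) +
        (((inner ℝ x u - m n) ^ 2 : ℝ) : ℂ) / 2 := by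
      rw [← hnθ]
      simp only [hg]
      push_cast
      ring
    simp_rw [eg]
    have i5 : Integrable (fun x => Complex.exp (θ n x * Complex.I) - 1) (μ n : Measure E) :=
      i1.sub (integrable_const _)
    have i6 : Integrable (fun x => ((n : ℕ) : ℂ) *
        (Complex.exp (θ n x * Complex.I) - 1 - θ n x * Complex.I)) (μ n : Measure E) :=
      (i5.sub i2).const_mul _
    rw [integral_add i6 i4, e3, integral_const_mul, integral_sub i5 i2, e2,
      integral_sub i1 (integrable_const _)]
    simp
  have hlimit : Tendsto (fun n : ℕ+ => ((n : ℕ) : ℂ) *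
      (∫ x, Complex.exp (θ n x * Complex.I) ∂(μ n : Measure E) - 1)) atTop
      (𝓝 (0 - (Var[fun x => inner ℝ x u; (μ₀ : Measure E)] : ℝ) / 2)) := by
    simp_rw [hmain]
    exact hg0.sub (((Complex.continuous_ofReal.tendsto _).comp hvar).div_const 2)
  have hfinal := tendsto_one_add_pow_pnat hlimit
  rw [zero_sub, ← neg_div] at hfinal
  refine hfinal.congr fun n => ?_
  rw [hψ, add_sub_cancel]

end PointwiseLimit

/-! ### Domination and the uniform local limit -/

section LocalLimit

variable {d : ℕ}

theorem integrable_exp_neg_mul_sq_norm {a : ℝ} (ha : 0 < a) :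
    Integrable fun u : EuclideanSpace ℝ (Fin d) => Real.exp (-a * ‖u‖ ^ 2) := by
  have h := (GaussianFourier.integrable_cexp_neg_mul_sq_norm_add (V := EuclideanSpace ℝ (Fin d))
    (b := a) (by simpa using ha) 0 0).norm
  refine h.congr (ae_of_all _ fun u => ?_)
  simp only [zero_mul, add_zero, Complex.norm_exp]
  norm_cast

/-- The characteristic function of the centred and normalised `n`-fold sum, cut off outside the
rescaled dual cell. -/
noncomputable def normalizedCharFun (b : Module.Basis (Fin d) ℝ (EuclideanSpace ℝ (Fin d)))
    (μ : Measure (EuclideanSpace ℝ (Fin d))) (n : ℕ+) (u : EuclideanSpace ℝ (Fin d)) : ℂ :=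
  ((fun u => (Real.sqrt (n : ℕ))⁻¹ • u) ⁻¹' dualCell b).indicator
    (fun u => (Complex.exp (-((Real.sqrt (n : ℕ))⁻¹ * ∫ x, inner ℝ x u ∂μ : ℝ) * Complex.I) *
        charFun μ ((Real.sqrt (n : ℕ))⁻¹ • u)) ^ (n : ℕ)) u

theorem measurable_normalizedCharFun (b : Module.Basis (Fin d) ℝ (EuclideanSpace ℝ (Fin d)))
    (μ : Measure (EuclideanSpace ℝ (Fin d))) [IsProbabilityMeasure μ] (n : ℕ+) :
    Measurable (normalizedCharFun b μ n) := by
  have h1 : Measurable fun u : EuclideanSpace ℝ (Fin d) => ∫ x, inner ℝ x u ∂μ := by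
    have : StronglyMeasurable fun u : EuclideanSpace ℝ (Fin d) => ∫ x, inner ℝ x u ∂μ :=
      StronglyMeasurable.integral_prod_right (f := fun u x : EuclideanSpace ℝ (Fin d) =>
        inner ℝ x u) (by unfold Function.uncurry; fun_prop)
    exact this.measurable
  refine Measurable.indicator ?_ ((isClosed_dualCell b).measurableSet.preimage (by fun_prop))
  have h2 : Measurable fun u : EuclideanSpace ℝ (Fin d) =>
      charFun μ ((Real.sqrt (n : ℕ))⁻¹ • u) := measurable_charFun.comp (by fun_prop)
  fun_prop

/-- The Gaussian bound is scale invariant: the n-th power cancels the factor 1/n from ‖u/√n‖². Off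
the cell the function is zero, so the bound holds on the whole space. -/
theorem norm_normalizedCharFun_le {b : Module.Basis (Fin d) ℝ (EuclideanSpace ℝ (Fin d))}
    {μ : Measure (EuclideanSpace ℝ (Fin d))} {a : ℝ}
    (h : ∀ t, (∀ j, |inner ℝ (b j) t| ≤ Real.pi) → ‖charFun μ t‖ ≤ Real.exp (-a * ‖t‖ ^ 2))
    (n : ℕ+) (u : EuclideanSpace ℝ (Fin d)) :
    ‖normalizedCharFun b μ n u‖ ≤ Real.exp (-a * ‖u‖ ^ 2) := by
  unfold normalizedCharFun
  by_cases hu : u ∈ (fun u => (Real.sqrt (n : ℕ))⁻¹ • u) ⁻¹' dualCell b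
  · rw [Set.indicator_of_mem hu, norm_pow, norm_mul, ← Complex.ofReal_neg,
      Complex.norm_exp_ofReal_mul_I, one_mul]
    refine (pow_le_pow_left₀ (norm_nonneg _) (h _ hu) _).trans_eq ?_
    rw [← Real.exp_nat_mul, norm_smul, mul_pow, norm_inv, inv_pow,
      Real.norm_of_nonneg (Real.sqrt_nonneg _), Real.sq_sqrt (by positivity)]
    congr 1
    have : ((n : ℕ) : ℝ) ≠ 0 := by simp
    field_simp
  · rw [Set.indicator_of_notMem hu, norm_zero]
    positivity

/-- Each fixed u eventually enters the rescaled cell, so the cutoff does not affect the limit. -/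
theorem tendsto_normalizedCharFun (b : Module.Basis (Fin d) ℝ (EuclideanSpace ℝ (Fin d)))
    {μ : ℕ+ → ProbabilityMeasure (EuclideanSpace ℝ (Fin d))}
    {μ₀ : ProbabilityMeasure (EuclideanSpace ℝ (Fin d))} (hlim : Tendsto μ atTop (𝓝 μ₀))
    (h : UniformlySquareIntegrable fun i => (μ i : Measure (EuclideanSpace ℝ (Fin d))))
    (u : EuclideanSpace ℝ (Fin d)) :
    Tendsto (fun n => normalizedCharFun b (μ n : Measure (EuclideanSpace ℝ (Fin d))) n u) atTop
      (𝓝 (Complex.exp (-(Var[fun x => inner ℝ x u;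
        (μ₀ : Measure (EuclideanSpace ℝ (Fin d)))] : ℝ) / 2))) := by
  refine (tendsto_charFun_pow hlim h u).congr' ?_
  have h1 : ∀ j, ∀ᶠ n : ℕ+ in atTop, |inner ℝ (b j) ((Real.sqrt (n : ℕ))⁻¹ • u)| ≤ Real.pi := by
    intro j
    have h2 : Tendsto (fun n : ℕ+ => |inner ℝ (b j) ((Real.sqrt (n : ℕ))⁻¹ • u)|) atTop
        (𝓝 |inner ℝ (b j) ((0 : ℝ) • u)|) := by
      have h3 : Tendsto (fun n : ℕ+ => (Real.sqrt (n : ℕ))⁻¹) atTop (𝓝 0) :=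
        tendsto_inv_atTop_zero.comp (Real.tendsto_sqrt_atTop.comp
          (tendsto_natCast_atTop_atTop.comp tendsto_PNat_val_atTop_atTop))
      exact (tendsto_const_nhds.inner (h3.smul_const u)).abs
    rw [zero_smul, inner_zero_right, abs_zero] at h2
    exact h2.eventually_le_const Real.pi_pos
  filter_upwards [eventually_all.2 h1] with n hn
  rw [normalizedCharFun, Set.indicator_of_mem (by exact hn)]

/-- Fourier inversion for the rescaled sum. -/
theorem sqrt_pow_mul_measureReal_singleton
    (b : Module.Basis (Fin d) ℝ (EuclideanSpace ℝ (Fin d)))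
    {μ ν : Measure (EuclideanSpace ℝ (Fin d))} [IsProbabilityMeasure μ] [IsProbabilityMeasure ν]
    (hμ : Integrable (fun x => ‖x‖ ^ 2) μ) (n : ℕ+)
    (hν : ∀ t, charFun ν t = charFun μ t ^ (n : ℕ)) {y : EuclideanSpace ℝ (Fin d)}
    (hy : ∀ᵐ x ∂ν, x - y ∈ Submodule.span ℤ (Set.range b)) :
    ((((n : ℕ) : ℝ) ^ ((d : ℝ) / 2) * ν.real {y} : ℝ) : ℂ) =
      latticeDet (Submodule.span ℤ (Set.range b)) / (2 * Real.pi) ^ d *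
      ∫ u, Complex.exp (-(inner ℝ ((Real.sqrt (n : ℕ))⁻¹ •
        (y - ((n : ℕ) : ℝ) • ∫ x, x ∂μ)) u : ℝ) * Complex.I) * normalizedCharFun b μ n u := by
  have hid : Integrable (fun x : EuclideanSpace ℝ (Fin d) => x) μ :=
    integrable_of_quadratic_growth (C := 1) hμ (by fun_prop)
      (fun x => by nlinarith [sq_nonneg (‖x‖ - 1 / 2)])
  have hinner (u : EuclideanSpace ℝ (Fin d)) :
      ∫ x, inner ℝ x u ∂μ = inner ℝ (∫ x, x ∂μ) u := by
    simp_rw [real_inner_comm u]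
    exact integral_inner hid u
  have hs : 0 < Real.sqrt (n : ℕ) := Real.sqrt_pos.2 (by exact_mod_cast n.pos)
  have hss : Real.sqrt (n : ℕ) * Real.sqrt (n : ℕ) = ((n : ℕ) : ℝ) :=
    Real.mul_self_sqrt (by positivity)
  -- The substitution t = u/√n has Jacobian factor (√n)^d = n^{d/2}, exactly the normalisation of
  -- the theorem.
  have h1 := Measure.integral_comp_smul (volume : Measure (EuclideanSpace ℝ (Fin d)))
    ((dualCell b).indicator fun t =>
      Complex.exp (-(inner ℝ y t : ℝ) * Complex.I) * charFun ν t) (Real.sqrt (n : ℕ))⁻¹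
  rw [integral_indicator (isClosed_dualCell b).measurableSet, finrank_euclideanSpace,
    Fintype.card_fin, inv_pow, inv_inv, abs_of_nonneg (by positivity)] at h1
  have hpow : ((n : ℕ) : ℝ) ^ ((d : ℝ) / 2) = Real.sqrt (n : ℕ) ^ d := by
    rw [Real.sqrt_eq_rpow, ← Real.rpow_mul_natCast (by positivity)]
    congr 1
    ring
  have h2 (u : EuclideanSpace ℝ (Fin d)) :
      (dualCell b).indicator (fun t =>
        Complex.exp (-(inner ℝ y t : ℝ) * Complex.I) * charFun ν t) ((Real.sqrt (n : ℕ))⁻¹ • u) =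
      Complex.exp (-(inner ℝ ((Real.sqrt (n : ℕ))⁻¹ •
        (y - ((n : ℕ) : ℝ) • ∫ x, x ∂μ)) u : ℝ) * Complex.I) * normalizedCharFun b μ n u := by
    unfold normalizedCharFun
    by_cases hu : (Real.sqrt (n : ℕ))⁻¹ • u ∈ dualCell b
    · rw [Set.indicator_of_mem hu, Set.indicator_of_mem (by exact hu), hν, mul_pow, ← mul_assoc,
        ← Complex.exp_nat_mul, ← Complex.exp_add, hinner]
      congr 2
      simp only [inner_smul_right, real_inner_smul_left, inner_sub_left]
      push_cast
      ring
    · rw [Set.indicator_of_notMem hu, Set.indicator_of_notMem (by exact hu), mul_zero]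
  simp_rw [h2] at h1
  rw [h1, Complex.ofReal_mul, measureReal_singleton_eq_setIntegral b ν hy, hpow, Complex.real_smul]
  ring

/-- The error `ε` is a constant times the L¹ distance between the normalised and Gaussian
characteristic functions. It is fixed before `ν` and `y`, which yields uniformity in `y`. -/
theorem exists_uniform_local_limit (b : Module.Basis (Fin d) ℝ (EuclideanSpace ℝ (Fin d)))
    {μ : ℕ+ → ProbabilityMeasure (EuclideanSpace ℝ (Fin d))}
    {μ₀ : ProbabilityMeasure (EuclideanSpace ℝ (Fin d))} (hlim : Tendsto μ atTop (𝓝 μ₀))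
    (h : UniformlySquareIntegrable fun i => (μ i : Measure (EuclideanSpace ℝ (Fin d))))
    (hb : ∀ j, ControlsCharacter
      (fun i => (μ i : Measure (EuclideanSpace ℝ (Fin d)))) atTop (b j))
    {S : Matrix (Fin d) (Fin d) ℝ} (hS : S.PosDef)
    (hvar : ∀ u : EuclideanSpace ℝ (Fin d),
      Var[fun x => inner ℝ x u; (μ₀ : Measure (EuclideanSpace ℝ (Fin d)))] =
        WithLp.ofLp u ⬝ᵥ S.mulVec (WithLp.ofLp u)) :
    ∃ ε : ℕ+ → ℝ, Tendsto ε atTop (𝓝 0) ∧ ∀ᶠ n in atTop,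
      ∀ (ν : Measure (EuclideanSpace ℝ (Fin d))) [IsProbabilityMeasure ν],
      (∀ t, charFun ν t = charFun (μ n : Measure (EuclideanSpace ℝ (Fin d))) t ^ (n : ℕ)) →
      ∀ y, (∀ᵐ x ∂ν, x - y ∈ Submodule.span ℤ (Set.range b)) →
        |((n : ℕ) : ℝ) ^ ((d : ℝ) / 2) * ν.real {y} -
          latticeDet (Submodule.span ℤ (Set.range b)) * gaussianDensity S
            ((Real.sqrt (n : ℕ))⁻¹ • (y - ((n : ℕ) : ℝ) •
              ∫ x, x ∂(μ n : Measure (EuclideanSpace ℝ (Fin d)))))| ≤ ε n := by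
  obtain ⟨a, ha, hdecay⟩ := exists_eventually_norm_charFun_le b hb
  set H : ℕ+ → EuclideanSpace ℝ (Fin d) → ℂ := fun n =>
    normalizedCharFun b (μ n : Measure (EuclideanSpace ℝ (Fin d))) n with hH
  set G : EuclideanSpace ℝ (Fin d) → ℂ := fun u =>
    Complex.exp (-(WithLp.ofLp u ⬝ᵥ S.mulVec (WithLp.ofLp u) : ℝ) / 2) with hG
  have hGcont : Continuous G := by
    have : Continuous fun u : EuclideanSpace ℝ (Fin d) =>
        WithLp.ofLp u ⬝ᵥ S.mulVec (WithLp.ofLp u) := by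
      simp only [dotProduct, Matrix.mulVec]
      fun_prop
    fun_prop
  have hHle : ∀ᶠ n in atTop, ∀ u, ‖H n u‖ ≤ Real.exp (-a * ‖u‖ ^ 2) :=
    hdecay.mono fun n hn => norm_normalizedCharFun_le hn n
  have hHG (u : EuclideanSpace ℝ (Fin d)) : Tendsto (fun n => H n u) atTop (𝓝 (G u)) := by
    have := tendsto_normalizedCharFun b hlim h u
    rwa [hvar] at this
  -- The limit inherits the bound, so the same Gaussian dominates both terms and no eigenvalue
  -- estimate for `S` is needed.
  have hGle (u : EuclideanSpace ℝ (Fin d)) : ‖G u‖ ≤ Real.exp (-a * ‖u‖ ^ 2) :=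
    le_of_tendsto (hHG u).norm (hHle.mono fun n hn => hn u)
  have hexp := integrable_exp_neg_mul_sq_norm (d := d) ha
  have hHmeas (n : ℕ+) : Measurable (H n) := measurable_normalizedCharFun b _ n
  have hzero : Tendsto (fun n => ∫ u, ‖H n u - G u‖) atTop (𝓝 0) := by
    have := tendsto_integral_filter_of_dominated_convergence (μ := volume) (l := atTop)
      (F := fun n u => ‖H n u - G u‖) (f := fun _ => 0)
      (fun u : EuclideanSpace ℝ (Fin d) => 2 * Real.exp (-a * ‖u‖ ^ 2))
      (Eventually.of_forall fun n =>
        ((hHmeas n).sub hGcont.measurable).norm.aestronglyMeasurable)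
      (hHle.mono fun n hn => ae_of_all _ fun u => by
        rw [norm_norm, two_mul]
        exact (norm_sub_le _ _).trans (add_le_add (hn u) (hGle u)))
      (hexp.const_mul 2)
      (ae_of_all _ fun u => by simpa using ((hHG u).sub_const (G u)).norm)
    simpa using this
  set D := latticeDet (Submodule.span ℤ (Set.range b)) with hD
  have hDpos : 0 < D := latticeDet_pos b
  refine ⟨fun n => D / (2 * Real.pi) ^ d * ∫ u, ‖H n u - G u‖, by simpa using hzero.const_mul _, ?_⟩
  filter_upwards [hHle] with n hn ν _ hν y hy
  set z := (Real.sqrt (n : ℕ))⁻¹ • (y - ((n : ℕ) : ℝ) •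
    ∫ x, x ∂(μ n : Measure (EuclideanSpace ℝ (Fin d)))) with hz
  have h1 : ((((n : ℕ) : ℝ) ^ ((d : ℝ) / 2) * ν.real {y} : ℝ) : ℂ) = D / (2 * Real.pi) ^ d *
      ∫ u, Complex.exp (-(inner ℝ z u : ℝ) * Complex.I) * H n u :=
    sqrt_pow_mul_measureReal_singleton b (h.1 n) n hν hy
  have h2 := integral_exp_quadratic_eq_gaussianDensity hS z
  have hphase (u : EuclideanSpace ℝ (Fin d)) :
      ‖Complex.exp (-(inner ℝ z u : ℝ) * Complex.I)‖ = 1 := by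
    rw [← Complex.ofReal_neg, Complex.norm_exp_ofReal_mul_I]
  have hHint : Integrable fun u => Complex.exp (-(inner ℝ z u : ℝ) * Complex.I) * H n u :=
    hexp.mono' (((by fun_prop : Measurable fun u : EuclideanSpace ℝ (Fin d) =>
      Complex.exp (-(inner ℝ z u : ℝ) * Complex.I)).mul (hHmeas n)).aestronglyMeasurable)
      (ae_of_all _ fun u => by rw [norm_mul, hphase, one_mul]; exact hn u)
  have hGint : Integrable fun u => Complex.exp (-(inner ℝ z u : ℝ) * Complex.I) * G u :=
    hexp.mono' (((by fun_prop : Measurable fun u : EuclideanSpace ℝ (Fin d) =>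
      Complex.exp (-(inner ℝ z u : ℝ) * Complex.I)).mul hGcont.measurable).aestronglyMeasurable)
      (ae_of_all _ fun u => by rw [norm_mul, hphase, one_mul]; exact hGle u)
  have h3 : ((((n : ℕ) : ℝ) ^ ((d : ℝ) / 2) * ν.real {y} - D * gaussianDensity S z : ℝ) : ℂ) =
      ((D / (2 * Real.pi) ^ d : ℝ) : ℂ) *
        ∫ u, Complex.exp (-(inner ℝ z u : ℝ) * Complex.I) * (H n u - G u) := by
    simp_rw [mul_sub]
    rw [integral_sub hHint hGint, Complex.ofReal_sub, h1, h2]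
    have hpi : (Real.pi : ℂ) ≠ 0 := by simp [Real.pi_ne_zero]
    generalize ∫ u, Complex.exp (-(inner ℝ z u : ℝ) * Complex.I) * H n u = J
    push_cast
    field_simp
  rw [← Real.norm_eq_abs, ← Complex.norm_real, h3, norm_mul, Complex.norm_real,
    Real.norm_of_nonneg (by positivity)]
  gcongr
  refine (norm_integral_le_integral_norm _).trans_eq ?_
  simp_rw [norm_mul, hphase, one_mul]

end LocalLimit

/-! ### Positive definiteness of the covariance -/

section Covariance

variable {d : ℕ} {Ω : Type*} [MeasurableSpace Ω] {P : Measure Ω} [IsProbabilityMeasure P]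
  {X : Ω → EuclideanSpace ℝ (Fin d)}

theorem variance_inner_map_eq (hX : MemLp X 2 P) (u : EuclideanSpace ℝ (Fin d)) :
    Var[fun x => inner ℝ x u; P.map X] =
      WithLp.ofLp u ⬝ᵥ (covMat X P).mulVec (WithLp.ofLp u) := by
  have hcoord (i : Fin d) : MemLp (fun ω => X ω i) 2 P :=
    (EuclideanSpace.proj (𝕜 := ℝ) i).comp_memLp' hX
  rw [variance_map (by fun_prop) hX.aemeasurable]
  have h1 : (fun x => inner ℝ x u) ∘ X = fun ω => ∑ i, u i * X ω i := by
    ext ω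
    simp [PiLp.inner_apply]
  rw [h1, variance_fun_sum fun i => (hcoord i).const_mul (u i)]
  simp only [dotProduct, Matrix.mulVec, covMat, Matrix.of_apply, Finset.mul_sum,
    covariance_const_mul_left, covariance_const_mul_right]
  exact Finset.sum_congr rfl fun i _ => Finset.sum_congr rfl fun j _ => by ring

/-- If ⟨x, u⟩ were almost surely constant, the closed support would lie in a hyperplane orthogonal
to u. The differences would then be orthogonal to u while spanning the space, so u = 0. -/
theorem IsNondegenerate.variance_inner_pos {μ : Measure (EuclideanSpace ℝ (Fin d))}
    [IsProbabilityMeasure μ] (hμ : IsNondegenerate μ) (h2 : Integrable (fun x => ‖x‖ ^ 2) μ)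
    {u : EuclideanSpace ℝ (Fin d)} (hu : u ≠ 0) : 0 < Var[fun x => inner ℝ x u; μ] := by
  refine (variance_nonneg _ _).lt_of_ne fun h0 => hu ?_
  have hae := ae_eq_integral_of_variance_eq_zero (memLp_inner_of_sq h2 u) h0.symm
  set m := ∫ x, inner ℝ x u ∂μ with hm
  have hsupp : μ.support ⊆ {x | inner ℝ x u = m} :=
    Measure.support_subset_of_isClosed (isClosed_eq (by fun_prop) continuous_const) hae
  obtain ⟨c, hc⟩ := Measure.nonempty_support (IsProbabilityMeasure.ne_zero μ)
  have hle : Submodule.span ℝ ((fun x => x - c) '' μ.support) ≤ LinearMap.ker (innerₗ _ u) := by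
    rw [Submodule.span_le]
    rintro _ ⟨x, hx, rfl⟩
    have hx' : inner ℝ x u = m := hsupp hx
    have hc' : inner ℝ c u = m := hsupp hc
    rw [real_inner_comm] at hx' hc'
    simp [inner_sub_right, hx', hc']
  rw [hμ.span_sub_eq_top c] at hle
  have : inner ℝ u u = (0 : ℝ) := hle (Submodule.mem_top (x := u))
  exact inner_self_eq_zero.1 this

theorem posDef_covMat (hX : MemLp X 2 P) (hμ : IsNondegenerate (P.map X)) :
    (covMat X P).PosDef := by
  have : IsProbabilityMeasure (P.map X) := Measure.isProbabilityMeasure_map hX.aemeasurable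
  refine Matrix.posDef_iff_dotProduct_mulVec.2 ⟨?_, fun v hv => ?_⟩
  · ext i j
    simp [covMat, covariance_comm]
  · have h2 : Integrable (fun x => ‖x‖ ^ 2) (P.map X) :=
      (integrable_map_measure (by fun_prop) hX.aemeasurable).2 (hX.integrable_norm_pow (by simp))
    have := hμ.variance_inner_pos h2 (u := WithLp.toLp 2 v) (by simpa using hv)
    rw [variance_inner_map_eq hX] at this
    simpa using this

end Covariance

theorem uniformlySquareIntegrable_map {ι E : Type*} [NormedAddCommGroup E] [MeasurableSpace E]
    [BorelSpace E] {Ω : ι → Type*} [∀ n, MeasurableSpace (Ω n)] {P : ∀ n, Measure (Ω n)}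
    [∀ n, IsProbabilityMeasure (P n)] {X : ∀ n, Ω n → E} (hX : ∀ n, AEMeasurable (X n) (P n))
    (hUI : Tendsto (fun L : ℝ => ⨆ n, ∫⁻ ω,
      Set.indicator {ω | L < ‖X n ω‖ ^ 2} (fun ω => ENNReal.ofReal (‖X n ω‖ ^ 2)) ω ∂(P n))
      atTop (𝓝 0)) :
    UniformlySquareIntegrable fun n => (P n).map (X n) := by
  have hmap (n : ι) (L : ℝ) : ∫⁻ ω, Set.indicator {ω | L < ‖X n ω‖ ^ 2}
      (fun ω => ENNReal.ofReal (‖X n ω‖ ^ 2)) ω ∂(P n) =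
      ∫⁻ x, Set.indicator {x | L < ‖x‖ ^ 2} (fun x => ENNReal.ofReal (‖x‖ ^ 2)) x
        ∂((P n).map (X n)) := by
    rw [lintegral_map' _ (hX n)]
    · rfl
    · exact (Measurable.indicator (by fun_prop)
        (measurableSet_lt measurable_const (by fun_prop))).aemeasurable
  have hprob (n : ι) : IsProbabilityMeasure ((P n).map (X n)) :=
    Measure.isProbabilityMeasure_map (hX n)
  have htail {ε : ℝ} (hε : 0 < ε) : ∃ L : ℝ, 1 ≤ L ∧ ∀ n,
      ∫⁻ x, Set.indicator {x | L < ‖x‖ ^ 2} (fun x => ENNReal.ofReal (‖x‖ ^ 2)) x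
        ∂((P n).map (X n)) ≤ ENNReal.ofReal ε := by
    obtain ⟨L, hL, hL1⟩ := ((hUI.eventually_le_const (ENNReal.ofReal_pos.2 hε)).and
      (eventually_ge_atTop 1)).exists
    refine ⟨L, hL1, fun n => ?_⟩
    rw [← hmap]
    exact (le_iSup (fun n => ∫⁻ ω, Set.indicator {ω | L < ‖X n ω‖ ^ 2}
      (fun ω => ENNReal.ofReal (‖X n ω‖ ^ 2)) ω ∂(P n)) n).trans hL
  refine ⟨fun n => ?_, fun ε hε => ?_⟩
  · obtain ⟨L, hL1, hL⟩ := htail one_pos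
    refine ⟨by fun_prop, ?_⟩
    rw [hasFiniteIntegral_iff_ofReal (ae_of_all _ fun x => by positivity)]
    calc ∫⁻ x, ENNReal.ofReal (‖x‖ ^ 2) ∂((P n).map (X n))
        ≤ ∫⁻ x, (ENNReal.ofReal L + Set.indicator {x | L < ‖x‖ ^ 2}
            (fun x => ENNReal.ofReal (‖x‖ ^ 2)) x) ∂((P n).map (X n)) := by
          refine lintegral_mono fun x => ?_
          by_cases hx : L < ‖x‖ ^ 2
          · rw [Set.indicator_of_mem (by exact hx)]
            exact le_add_self
          · exact (ENNReal.ofReal_le_ofReal (not_lt.1 hx)).trans le_self_add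
      _ = ENNReal.ofReal L + ∫⁻ x, Set.indicator {x | L < ‖x‖ ^ 2}
            (fun x => ENNReal.ofReal (‖x‖ ^ 2)) x ∂((P n).map (X n)) := by
          rw [lintegral_add_left measurable_const]
          simp
      _ < ∞ := ENNReal.add_lt_top.2 ⟨ENNReal.ofReal_lt_top,
          (hL n).trans_lt ENNReal.ofReal_lt_top⟩
  · obtain ⟨L, hL1, hL⟩ := htail hε
    refine ⟨L, hL1, fun n => ?_⟩
    have hms : MeasurableSet {x : E | L < ‖x‖} := measurableSet_lt measurable_const measurable_norm
    rw [integral_eq_lintegral_of_nonneg_ae (ae_of_all _ fun x => by positivity) (by fun_prop)]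
    refine ENNReal.toReal_le_of_le_ofReal hε.le (le_trans ?_ (hL n))
    rw [← lintegral_indicator hms]
    -- Since L ≥ 1, the condition L < ‖x‖ implies L < ‖x‖², so the same threshold serves for the
    -- norm and its square.
    refine lintegral_mono fun x => Set.indicator_le_indicator_of_subset (fun x hx => ?_)
      (fun _ => zero_le) x
    have hx' : L < ‖x‖ := hx
    change L < ‖x‖ ^ 2
    nlinarith

end LatticeLLT

/-! ### The local limit theorem -/

theorem mainTheorem7 {d : ℕ}
    -- the random variables `X_n`, `n ≥ 1`, each on its own probability space
    {Ω : ℕ+ → Type*} [∀ n, MeasurableSpace (Ω n)]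
    (P : ∀ n, Measure (Ω n)) [∀ n, IsProbabilityMeasure (P n)]
    (X : ∀ n, Ω n → EuclideanSpace ℝ (Fin d))
    -- the triangular array `X_{n,1}, …, X_{n,n}`
    {Ω' : ℕ+ → Type*} [∀ n, MeasurableSpace (Ω' n)]
    (P' : ∀ n, Measure (Ω' n)) [∀ n, IsProbabilityMeasure (P' n)]
    (Y : ∀ n : ℕ+, Fin (n : ℕ) → Ω' n → EuclideanSpace ℝ (Fin d))
    (hindep : ∀ n, iIndepFun (Y n) (P' n))
    (hident : ∀ n i, IdentDistrib (Y n i) (X n) (P' n) (P n))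
    -- the limit `X_∞`
    {Ω₀ : Type*} [MeasurableSpace Ω₀] (P₀ : Measure Ω₀) [IsProbabilityMeasure P₀]
    (X₀ : Ω₀ → EuclideanSpace ℝ (Fin d))
    (hnondeg : LatticeLLT.IsNondegenerate (P₀.map X₀))
    (hlim : TendstoInDistribution X atTop X₀ P P₀)
    -- the common main lattice
    (Λ : Submodule ℤ (EuclideanSpace ℝ (Fin d)))
    (hΛ : ∀ n, LatticeLLT.IsMainLattice ((P n).map (X n)) Λ)
    (hΛ₀ : LatticeLLT.IsMainLattice (P₀.map X₀) Λ)
    -- uniform integrability of `‖X_n‖ ^ 2`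
    (hUI : Tendsto (fun L : ℝ => ⨆ n, ∫⁻ ω,
      Set.indicator {ω | L < ‖X n ω‖ ^ 2} (fun ω => ENNReal.ofReal (‖X n ω‖ ^ 2)) ω ∂(P n))
      atTop (𝓝 0)) :
    MemLp X₀ 2 P₀ ∧
    -- the normal law `N(0, Cov X)` has a density
    (LatticeLLT.covMat X₀ P₀).PosDef ∧
    ∀ c : ℕ+ → EuclideanSpace ℝ (Fin d),
      (∀ n, ((P' n).map (fun ω => ∑ i, Y n i ω)).support ⊆ LatticeLLT.coset (c n) Λ) →
      Tendsto (fun n : ℕ+ => ⨆ y ∈ LatticeLLT.coset (c n) Λ,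
        ENNReal.ofReal
          |((n : ℕ) : ℝ) ^ ((d : ℝ) / 2) * (P' n).real {ω | ∑ i, Y n i ω = y} -
            LatticeLLT.latticeDet Λ * LatticeLLT.gaussianDensity (LatticeLLT.covMat X₀ P₀)
              ((Real.sqrt ((n : ℕ) : ℝ))⁻¹ • (y - ((n : ℕ) : ℝ) • ∫ ω, X n ω ∂(P n)))|)
        atTop (𝓝 0) := by
  have hX := hlim.forall_aemeasurable
  have hX₀ := hlim.aemeasurable_limit
  let μ : ℕ+ → ProbabilityMeasure (EuclideanSpace ℝ (Fin d)) := fun n =>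
    ⟨(P n).map (X n), Measure.isProbabilityMeasure_map (hX n)⟩
  let μ₀ : ProbabilityMeasure (EuclideanSpace ℝ (Fin d)) :=
    ⟨P₀.map X₀, Measure.isProbabilityMeasure_map hX₀⟩
  have hμ : Tendsto μ atTop (𝓝 μ₀) := hlim.tendsto
  have hUI' : LatticeLLT.UniformlySquareIntegrable
      fun n => (μ n : Measure (EuclideanSpace ℝ (Fin d))) :=
    LatticeLLT.uniformlySquareIntegrable_map hX hUI
  have hsq : Integrable (fun x => ‖x‖ ^ 2) (P₀.map X₀) :=
    LatticeLLT.integrable_norm_sq_of_tendsto hμ hUI'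
  have hL2 : MemLp X₀ 2 P₀ := (memLp_two_iff_integrable_sq_norm hX₀.aestronglyMeasurable).2
    ((integrable_map_measure (by fun_prop) hX₀).1 hsq)
  have hpos := LatticeLLT.posDef_covMat hL2 hnondeg
  refine ⟨hL2, hpos, fun c hc => ?_⟩
  obtain ⟨x₀, hx₀, hspan⟩ := hΛ₀.exists_eq_span hnondeg
  have hlat : LatticeLLT.IsLattice Λ := by
    obtain ⟨_, _, ⟨h, _⟩, _⟩ := hΛ₀
    exact h
  -- Differences in the support of the limit are controlled and generate Λ. The laws of the X_n
  -- enter through weak convergence and their concentration on cosets of Λ.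
  have hctrl : ∀ v ∈ Λ, LatticeLLT.ControlsCharacter
      (fun n => (μ n : Measure (EuclideanSpace ℝ (Fin d)))) atTop v := by
    intro v hv
    have := hlat.discreteTopology
    rw [hspan] at hv
    refine LatticeLLT.controlsCharacter_of_mem_span ?_ hv
    rintro _ ⟨x, hx, rfl⟩
    refine LatticeLLT.controlsCharacter_sub_of_mem_support hμ (Λ := Λ)
      (fun n => (hΛ n).exists_ae_sub_mem) hx hx₀ ?_
    rw [hspan]
    exact Submodule.subset_span ⟨x, hx, rfl⟩
  obtain ⟨b, rfl⟩ := hlat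
  obtain ⟨ε, hε, hev⟩ := LatticeLLT.exists_uniform_local_limit b hμ hUI'
    (fun j => hctrl (b j) (Submodule.subset_span ⟨j, rfl⟩)) hpos
    (fun u => LatticeLLT.variance_inner_map_eq hL2 u)
  have hε' : Tendsto (fun n => ENNReal.ofReal (ε n)) atTop (𝓝 0) := by
    simpa using ENNReal.tendsto_ofReal hε
  refine tendsto_of_tendsto_of_tendsto_of_le_of_le' tendsto_const_nhds hε'
    (Eventually.of_forall fun n => zero_le) ?_
  filter_upwards [hev] with n hn
  refine iSup₂_le fun y hy => ENNReal.ofReal_le_ofReal ?_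
  have hY (i : Fin (n : ℕ)) : AEMeasurable (Y n i) (P' n) := (hident n i).aemeasurable_fst
  have hsum : AEMeasurable (fun ω => ∑ i, Y n i ω) (P' n) :=
    Finset.aemeasurable_fun_sum _ fun i _ => hY i
  have : IsProbabilityMeasure ((P' n).map fun ω => ∑ i, Y n i ω) :=
    Measure.isProbabilityMeasure_map hsum
  have hchar (t : EuclideanSpace ℝ (Fin d)) : charFun ((P' n).map fun ω => ∑ i, Y n i ω) t =
      charFun (μ n : Measure (EuclideanSpace ℝ (Fin d))) t ^ (n : ℕ) := by
    rw [(hindep n).charFun_map_fun_sum_eq_prod hY]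
    simp [fun i => (hident n i).map_eq, μ]
  -- The sum and y lie in the same coset c_n + Λ, so the unknown shift cancels.
  have hmem : ∀ᵐ x ∂((P' n).map fun ω => ∑ i, Y n i ω),
      x - y ∈ Submodule.span ℤ (Set.range b) := by
    filter_upwards [Measure.support_mem_ae (μ := (P' n).map fun ω => ∑ i, Y n i ω)] with x hx
    obtain ⟨v, hv, rfl⟩ := hc n hx
    obtain ⟨w, hw, rfl⟩ := hy
    rw [add_sub_add_left_eq_sub]
    exact Submodule.sub_mem _ hv hw
  have h := hn _ hchar y hmem
  have h1 : ((P' n).map fun ω => ∑ i, Y n i ω).real {y} =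
      (P' n).real {ω | ∑ i, Y n i ω = y} := by
    rw [measureReal_def, Measure.map_apply_of_aemeasurable hsum (measurableSet_singleton y)]
    rfl
  have h2 : ∫ x, x ∂(μ n : Measure (EuclideanSpace ℝ (Fin d))) = ∫ ω, X n ω ∂(P n) :=
    integral_map (hX n) (by fun_prop)
  rwa [h1, h2] at h
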